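/- **Definitions.** A *long w-link diagram* is a planar diagram of one oriented open component and finitely many oriented closed components, with positive, negative and virtual crossings. A *long w-link* is a class of such diagrams modulo planar isotopy, the Reidemeister moves 2 and 3, the virtual Reidemeister moves 1–3, the mixed moves, and the overcrossings-commute relation (neither Reidemeister 1 nor undercrossings-commute is imposed). Equivalently it is given by its signed Gauss code (for each component, the sequence of over- and under-passages through classical crossings), modulo the same moves. The *writhe* $w(L)$ is the number of positive minus the number of negative crossings. *$\Gamma$-calculus* assigns to a w-tangle $T$ (no closed components) with components labelled by a finite set $X$ a scalar $\omega\in\mathbb{Q}(t_i: i\in X)$ and a matrix $M$ with rows $y_i$ and columns $x_j$ ($i,j\in X$), as follows. A crossing of sign $\pm$ with over-strand $a$ and under-strand $b$ has scalar $1$ and matrix entries $M_{aa}=1$, $M_{ab}=1-t_a^{\pm1}$, $M_{ba}=0$, $M_{bb}=t_a^{\pm1}$. A trivial strand has scalar $1$ and matrix $(1)$. Under disjoint union the scalars are multiplied and the matrices are put in block-diagonal form. Joining the head of strand $a$ to the tail of a different strand $b$, and calling the result $c$, replaces, with $\gamma=M_{ba}$, the scalar $\omega$ by $(1-\gamma)\omega$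 and each entry $M_{ij}$ with $i\ne b$, $j\ne a$ by $M_{ij}+M_{ia}M_{bj}/(1-\gamma)$; then row $y_a$ is renamed $y_c$, column $x_b$ is renamed $x_c$, and $t_a,t_b$ are replaced by $t_c$. For a long w-link $L$ let $T$ be a w-tangle obtained from a diagram of $L$ by cutting each closed component once. If $\omega$ is the scalar of $T$ and $\alpha$ the square block of its matrix whose rows and columns belong to the cut closed components, put $\omega_L(t)=\omega\det(I-\alpha)$ with all variables $t_i$ set equal to $t$, and $$\Delta_L(t)=t^{-w(L)/2}\,\omega_L(t)\in\mathbb{Q}(t^{1/2}).$$ **Theorem (Alexander–Conway skein relation).** $\Delta_L$ is well defined, i.e. it depends only on the long w-link $L$ and not on the diagram or on the places where the closed components are cut. If $L_+$, $L_-$, $L_0$ are long w-links with diagrams that are identical except near one crossing, where $L_+$ has a positive crossing, $L_-$ a negative crossing, and $L_0$ the smoothing of this crossing that respects the orientations, then $$\Delta_{L_+}(t)-\Delta_{L_-}(t)=(t^{-1/2}-t^{1/2})\,\Delta_{L_0}(t).$$ -/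

import Mathlib

/-! Long w-links are encoded by signed Gauss codes: in a diagram all virtual crossings are
forgotten and one records, along each component, the classical crossings it passes and whether it
passes over or under.  (Two diagrams with the same Gauss code differ by planar isotopy and the
virtual moves VR1, VR2, VR3 and M, and every Gauss code is the code of a diagram.) -/

noncomputable section

namespace WLink

/-! ### Diagrams of long w-links -/

/-- One passage of a component through a classical crossing: the name of the crossing, its sign,
and whether the passage is the over- or the under-passage. -/
@[ext]
structure Letter where
  crossing : ℕ
  sign : ℤˣ
  isOver : Bool
deriving DecidableEq

/-- The other passage through the same crossing. -/
def Letter.flip (p : Letter) : Letter := ⟨p.crossing, p.sign, !p.isOver⟩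

/-- Renaming of the crossings. -/
def Letter.rename (f : ℕ → ℕ) (p : Letter) : Letter := ⟨f p.crossing, p.sign, p.isOver⟩

/-- The effect on a passage of switching over and under at the crossing `c` (the sign of this
crossing changes too); passages through other crossings stay the same. -/
def Letter.switch (c : ℕ) (p : Letter) : Letter :=
  if p.crossing = c then ⟨p.crossing, -p.sign, !p.isOver⟩ else p

/-- A diagram of a long w-link: the oriented open component `strand`, read from its tail to its
head, and finitely many oriented closed components `circles`, each read from an arbitrary base
point; the empty word is a closed component without classical crossings.  Every crossing that
occurs is passed exactly once over and exactly once under, with the same sign. -/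
@[ext]
structure Diagram where
  strand : List Letter
  circles : List (List Letter)
  nodup : ((strand ++ circles.flatten).map fun p => (p.crossing, p.isOver)).Nodup
  flip_mem : ∀ p ∈ strand ++ circles.flatten, p.flip ∈ strand ++ circles.flatten

namespace Diagram

/-- All passages through crossings. -/
def letters (D : Diagram) : List Letter := D.strand ++ D.circles.flatten

/-- The over-passages; they correspond to the crossings of the diagram. -/
def overLetters (D : Diagram) : List Letter := D.letters.filter fun p => p.isOver

/-- The writhe: the sum of the signs of all crossings. -/
def writhe (D : Diagram) : ℤ := (D.overLetters.map fun p => (p.sign : ℤ)).sum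

/-- `D'` is obtained from `D` by transforming the word of every component by `f`. -/
def IsImage (f : List Letter → List Letter) (D D' : Diagram) : Prop :=
  D'.strand = f D.strand ∧ D'.circles = D.circles.map f

/-- The passage `p` is immediately followed by the passage `q` (away from the base point). -/
def Adj (D : Diagram) (p q : Letter) : Prop :=
  [p, q] <:+: D.strand ∨ ∃ w ∈ D.circles, [p, q] <:+: w

/-- `p` and `q` are consecutive, in this order if `ε = 1` and in the opposite order
if `ε = -1`. -/
def AdjSigned (D : Diagram) (ε : ℤˣ) (p q : Letter) : Prop :=
  if ε = 1 then D.Adj p q else D.Adj q p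

/-- The moves that generate w-equivalence of diagrams.  The first three identify codes of the same
diagram (names of crossings, base points, and the order of the closed components are immaterial).
Exchanging consecutive passages `p`, `q` is the same as substituting `p ↔ q` in all words.

In `r3`, the crossings are `tm` (top strand over middle strand), `tb` (top over bottom) and
`mb` (middle over bottom), each given by its over-passage.  The orders in which the three
strands meet the vertices of the triangle are determined by the three signs up to a global
reversal `κ`, and the move reverses all three orders.

Reidemeister 1 and the commutation of undercrossings are not among the moves. -/
inductive Move : Diagram → Diagram → Prop
  | rename {D D' : Diagram} (f : Equiv.Perm ℕ) (h : IsImage (List.map (Letter.rename f)) D D') :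
      Move D D'
  | rotate {D D' : Diagram} (u v : List Letter) (rest : List (List Letter))
      (hs : D'.strand = D.strand) (h : D.circles = (u ++ v) :: rest)
      (h' : D'.circles = (v ++ u) :: rest) : Move D D'
  | reorder {D D' : Diagram} (hs : D'.strand = D.strand) (h : D.circles.Perm D'.circles) :
      Move D D'
  | r2 {D D' : Diagram} (a b : Letter) (ha : a.isOver = true) (hb : b.isOver = true)
      (hsign : b.sign = -a.sign) (hover : D.Adj a b)
      (hunder : D.Adj a.flip b.flip ∨ D.Adj b.flip a.flip)
      (h : IsImage (List.filter fun p => p.crossing ≠ a.crossing ∧ p.crossing ≠ b.crossing) D D') :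
      Move D D'
  | r3 {D D' : Diagram} (tm tb mb : Letter) (κ : ℤˣ)
      (htm : tm.isOver = true) (htb : tb.isOver = true) (hmb : mb.isOver = true)
      (h₁ : tm.crossing ≠ tb.crossing) (h₂ : tm.crossing ≠ mb.crossing)
      (h₃ : tb.crossing ≠ mb.crossing)
      (top : D.AdjSigned (κ * tb.sign) tm tb)
      (middle : D.AdjSigned (κ * mb.sign) tm.flip mb)
      (bottom : D.AdjSigned (κ * tm.sign * mb.sign * tb.sign) tb.flip mb.flip)
      (h : IsImage (List.map fun p => Equiv.swap tm tb (Equiv.swap tm.flip mb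
        (Equiv.swap tb.flip mb.flip p))) D D') :
      Move D D'
  | oc {D D' : Diagram} (a b : Letter) (ha : a.isOver = true) (hb : b.isOver = true)
      (hover : D.Adj a b) (h : IsImage (List.map (Equiv.swap a b)) D D') :
      Move D D'

/-- `D₀` is the oriented smoothing of `D` at the crossing `c`.  The cases: the two passages `p`,
`q` of `c` lie both on the open component; one on the open component and one on a closed
component; both on the same closed component; on two distinct closed components. -/
inductive IsSmoothing (c : ℕ) : Diagram → Diagram → Prop
  | open_open {D D₀ : Diagram} (p q : Letter) (hp : p.crossing = c) (hq : q.crossing = c)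
      (u v w : List Letter) (hs : D.strand = u ++ p :: (v ++ q :: w))
      (hs₀ : D₀.strand = u ++ w) (h₀ : D₀.circles = v :: D.circles) : IsSmoothing c D D₀
  | open_closed {D D₀ : Diagram} (p q : Letter) (hp : p.crossing = c) (hq : q.crossing = c)
      (u v w : List Letter) (hs : D.strand = u ++ p :: w)
      (h : D.circles = (q :: v) :: D₀.circles) (hs₀ : D₀.strand = u ++ (v ++ w)) :
      IsSmoothing c D D₀
  | closed_self {D D₀ : Diagram} (p q : Letter) (hp : p.crossing = c) (hq : q.crossing = c)
      (u v : List Letter) (rest : List (List Letter))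
      (h : D.circles = (p :: (u ++ q :: v)) :: rest) (hs₀ : D₀.strand = D.strand)
      (h₀ : D₀.circles = u :: v :: rest) : IsSmoothing c D D₀
  | closed_closed {D D₀ : Diagram} (p q : Letter) (hp : p.crossing = c) (hq : q.crossing = c)
      (u v : List Letter) (rest : List (List Letter))
      (h : D.circles = (p :: u) :: (q :: v) :: rest) (hs₀ : D₀.strand = D.strand)
      (h₀ : D₀.circles = (u ++ v) :: rest) : IsSmoothing c D D₀

end Diagram

/-- Long w-links: diagrams modulo the equivalence relation generated by the moves. -/
def LongWLink : Type := Quot Diagram.Move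

/-- The long w-link represented by a diagram. -/
def LongWLink.mk (D : Diagram) : LongWLink := Quot.mk Diagram.Move D

/-- `Lp`, `Lm`, `L₀` have diagrams that are identical except near one crossing `c`, which is
positive in the first diagram, replaced by the negative crossing in the second one, and smoothed
according to the orientations in the third one. -/
def IsSkeinTriple (Lp Lm L₀ : LongWLink) : Prop :=
  ∃ (Dp Dm D₀ : Diagram) (c : ℕ),
    LongWLink.mk Dp = Lp ∧ LongWLink.mk Dm = Lm ∧ LongWLink.mk D₀ = L₀ ∧
    (∃ p ∈ Dp.letters, p.crossing = c ∧ p.sign = 1) ∧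
    Diagram.IsImage (List.map (Letter.switch c)) Dp Dm ∧
    Diagram.IsSmoothing c Dp D₀

/-! ### Gamma-calculus -/

/-- Labels of the strands of the tangles that occur: the over- and the under-strand of a single
crossing, and the strands `comp i` that become the components of a tangle. -/
inductive Label where
  | over (c : ℕ)
  | under (c : ℕ)
  | comp (i : ℕ)
deriving DecidableEq

/-- The polynomials in the variables `t_i` that do not vanish when all `t_i` are set to `1`. -/
def denominators : Submonoid (MvPolynomial Label ℚ) where
  carrier := {p | MvPolynomial.eval (fun _ => (1 : ℚ)) p ≠ 0}
  one_mem' := by simp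
  mul_mem' := by
    intro p q hp hq
    simp only [Set.mem_ofPred_eq, map_mul] at *
    exact mul_ne_zero hp hq

/-- Rational functions in the variables `t_i`, with rational coefficients, for which the
substitution `t_i → 1` makes sense, as is required of all entries in Gamma-calculus. -/
abbrev RegularFunction : Type := Localization denominators

/-- The variable `t_a`. -/
def tVar (a : Label) : RegularFunction :=
  algebraMap (MvPolynomial Label ℚ) RegularFunction (MvPolynomial.X a)

lemma isUnit_tVar (a : Label) : IsUnit (tVar a) :=
  IsLocalization.map_units RegularFunction
    (⟨MvPolynomial.X a, show MvPolynomial.eval (fun _ : Label => (1 : ℚ)) (MvPolynomial.X a) ≠ 0 by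
      simp⟩ : denominators)

/-- `t_a ^ ε` for a sign `ε`. -/
def tPow (a : Label) (ε : ℤˣ) : RegularFunction :=
  (((isUnit_tVar a).unit ^ (ε : ℤ) : RegularFunctionˣ) : RegularFunction)

lemma denominators_le_comap (f : Label → Label) :
    denominators ≤ denominators.comap (MvPolynomial.rename f : _ →ₐ[ℚ] _) := by
  intro p hp
  have hp' : MvPolynomial.eval (fun _ => (1 : ℚ)) p ≠ 0 := hp
  change MvPolynomial.eval (fun _ => (1 : ℚ)) (MvPolynomial.rename f p) ≠ 0
  rw [MvPolynomial.eval_rename]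
  exact hp'

/-- The substitution `t_i → t_{f i}`. -/
def substVars (f : Label → Label) : RegularFunction →+* RegularFunction :=
  IsLocalization.map RegularFunction
    ((MvPolynomial.rename f : MvPolynomial Label ℚ →ₐ[ℚ] MvPolynomial Label ℚ) :
      MvPolynomial Label ℚ →+* MvPolynomial Label ℚ) (denominators_le_comap f)

/-- Elements of Gamma-calculus: a scalar part and a matrix part, with rows `y_i` and columns `x_j`.
An element with a finite set `X` of labels is written with its matrix extended by zero
outside `X × X`. -/
@[ext]
structure Gamma where
  scalar : RegularFunction
  mat : Matrix Label Label RegularFunction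

namespace Gamma

/-- The element with no strands. -/
def empty : Gamma := ⟨1, 0⟩

/-- Disjoint union; the sum of the matrices is block diagonal when the label sets are disjoint. -/
def disjointUnion (g h : Gamma) : Gamma := ⟨g.scalar * h.scalar, g.mat + h.mat⟩

/-- The identity operation `e_a`: add a trivial strand with the new label `a`. -/
def addTrivial (a : Label) (g : Gamma) : Gamma := ⟨g.scalar, g.mat + Matrix.single a a 1⟩

/-- The value of a crossing of sign `ε` with over-strand `a` and under-strand `b`. -/
def crossing (ε : ℤˣ) (a b : Label) : Gamma where
  scalar := 1
  mat := Matrix.single a a 1 + Matrix.single a b (1 - tPow a ε) + Matrix.single b b (tPow a ε)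

/-- Stitching `m^{a,b}_c`: the head of strand `a` is joined to the tail of strand `b`, and the
resulting strand is called `c`.  With `γ` the entry in row `y_b` and column `x_a`, the scalar is
multiplied by `1 - γ`; the matrix `M` becomes `M i j + M i a * M b j / (1 - γ)`; row `y_b` and
column `x_a` are removed; row `y_a` and column `x_b` are called `y_c` and `x_c`; finally `t_a` and
`t_b` are replaced by `t_c`.  The element `1 - γ` is a unit because `γ` becomes `0`
for `t_i → 1`. -/
def stitch (a b c : Label) (g : Gamma) : Gamma where
  scalar := substVars (fun i => if i = a ∨ i = b then c else i) ((1 - g.mat b a) * g.scalar)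
  mat := Matrix.of fun i j =>
    if (i ≠ c ∧ (i = a ∨ i = b)) ∨ (j ≠ c ∧ (j = a ∨ j = b)) then 0
    else
      let i' := if i = c then a else i
      let j' := if j = c then b else j
      substVars (fun i => if i = a ∨ i = b then c else i)
        (g.mat i' j' + g.mat i' a * g.mat b j' * Ring.inverse (1 - g.mat b a))

/-- The trace map for the closed components `comp 1, …, comp k`:
the scalar part times `det (I - α)`, where `α` is the block of these components. -/
def trace (k : ℕ) (g : Gamma) : RegularFunction :=
  g.scalar * (1 - Matrix.of fun i j : Fin k =>
    g.mat (Label.comp (i + 1)) (Label.comp (j + 1))).det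

end Gamma

/-- The strand of a single crossing to which a passage corresponds. -/
def Letter.label (p : Letter) : Label :=
  if p.isOver then Label.over p.crossing else Label.under p.crossing

/-- Stitch to the strand `a` the strands named in the word `w` one after the other; the result
is again called `a`. -/
def stitchWord (a : Label) (w : List Letter) (g : Gamma) : Gamma :=
  w.foldl (fun h p => h.stitch a p.label a) g

/-- Stitch together the strands `comp n, comp (n + 1), …` according to a list of words, each
strand `comp i` starting as a trivial strand. -/
def stitchWords : ℕ → List (List Letter) → Gamma → Gamma
  | _, [], g => g
  | n, w :: ws, g =>
      stitchWords (n + 1) ws (stitchWord (Label.comp n) w (g.addTrivial (Label.comp n)))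

namespace Diagram

/-- The disjoint union of all crossings of the diagram. -/
def crossings (D : Diagram) : Gamma :=
  (D.overLetters.map fun p =>
    Gamma.crossing p.sign (Label.over p.crossing) (Label.under p.crossing)).foldr
      Gamma.disjointUnion Gamma.empty

/-- The value `φ(T)` in Gamma-calculus of the w-tangle `T` obtained from the diagram by cutting
every closed component at its base point.  The open component has label `comp 0` and the closed
components become strands with labels `comp 1, comp 2, …`. -/
def phi (D : Diagram) : Gamma := stitchWords 0 (D.strand :: D.circles) D.crossings

end Diagram

/-- The element `t^{1/2}` of the field `ℚ(t^{1/2})` of rational functions in `t^{1/2}`. -/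
def sqrtT : RatFunc ℚ := RatFunc.X

lemma isUnit_aeval_denominators (p : denominators) :
    IsUnit ((MvPolynomial.aeval (fun _ : Label => sqrtT ^ 2) :
      MvPolynomial Label ℚ →ₐ[ℚ] RatFunc ℚ) p) := by
  obtain ⟨p, hp⟩ := p
  have hp' : MvPolynomial.eval (fun _ => (1 : ℚ)) p ≠ 0 := hp
  rw [isUnit_iff_ne_zero]
  intro h
  have h1 : (MvPolynomial.aeval (fun _ : Label => sqrtT ^ 2) :
      MvPolynomial Label ℚ →ₐ[ℚ] RatFunc ℚ) p
      = algebraMap (Polynomial ℚ) (RatFunc ℚ)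
          (MvPolynomial.aeval (fun _ : Label => (Polynomial.X ^ 2 : Polynomial ℚ)) p) := by
    rw [MvPolynomial.aeval_def, MvPolynomial.aeval_def, MvPolynomial.hom_eval₂]
    congr 1
    · exact Subsingleton.elim _ _
    · funext i
      simp [sqrtT]
  rw [h1] at h
  have h2 := (map_eq_zero_iff _ (RatFunc.algebraMap_injective ℚ)).1 h
  apply hp'
  have h3 := congrArg (Polynomial.eval (1 : ℚ)) h2
  rw [MvPolynomial.aeval_def, ← Polynomial.coe_evalRingHom, MvPolynomial.hom_eval₂] at h3
  simp only [map_zero] at h3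
  rw [← h3, MvPolynomial.eval, MvPolynomial.coe_eval₂Hom]
  congr 1
  · exact Subsingleton.elim _ _
  · funext i
    simp

/-- Identification of all variables `t_i` with `t = (t^{1/2})²`. -/
def specialize : RegularFunction →+* RatFunc ℚ :=
  IsLocalization.lift (M := denominators)
    (g := ((MvPolynomial.aeval (fun _ : Label => sqrtT ^ 2) :
      MvPolynomial Label ℚ →ₐ[ℚ] RatFunc ℚ) : MvPolynomial Label ℚ →+* RatFunc ℚ))
    isUnit_aeval_denominators

/-- The trace invariant `ω_L(t)`, computed from a diagram of `L`. -/
def Diagram.omega (D : Diagram) : RatFunc ℚ := specialize (D.phi.trace D.circles.length)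

end WLink

end

/-! Stitching in Gamma-calculus is Gaussian elimination. Let `M` be the matrix of all strands before
any stitching, and let `S` be the matrix of the permutation sending each strand to the one that
follows it along its component. If the head of `a` meets the tail of `b`, the diagonal entry of `1 -
M S` at `b` is `1 - M b a`. Taking it as pivot contributes the scalar of the stitching, and the
Schur complement is `1 - M' S'` for the stitched matrix `M'` (`permDet_stitch`). The trace map is
the determinant left at the end, so `ω` is the single determinant `det (1 - M S)`
(`omega_eq_wordDet`). The open component is treated as closed too, but the row of its base point in
`M` is set to zero, so the closing has no effect.

The matrix `crossingMat` depends only on the signs of the crossings, while the combinatorics of the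
diagram sits in cyclic words of labels. Base points of closed components are trivial strands and can
be inserted, erased and renamed, which gives independence of the cuts. In a Reidemeister move the
arcs involved are eliminated on both sides and the small blocks that remain are compared
(`wordDet_reidemeister2`, `wordDet_reidemeister3`, `wordDet_swap`). The writhe is unchanged as well,
so `Δ` is well defined.

For the skein relation, the matrices of the three diagrams differ only in the two rows of the
crossing. In these rows the determinant is an alternating bilinear form, and expanding it gives `ω₊
- t ω₋ = (1 - t) ω₀` (`permDet_skein`). Here the smoothing appears as a crossing with `t` replaced
by `1`, hence with two trivial strands, glued after exchanging their successors
(`IsSmoothing.permDet_eq`). Multiplication by a power of `t^{1/2}` turns this into the stated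
relation. -/

noncomputable section

namespace WLink

open Equiv

/-! ### Stitching as Gaussian elimination -/

section LinearAlgebra

variable {α : Type*} [DecidableEq α] {K : Type*} [Field K]

/-- The principal minor of `A` with rows and columns in `s`. -/
def detOn (s : Finset α) (A : Matrix α α K) : K :=
  (A.submatrix (Subtype.val : s → α) Subtype.val).det

theorem detOn_congr {s : Finset α} {A B : Matrix α α K}
    (h : ∀ i ∈ s, ∀ j ∈ s, A i j = B i j) : detOn s A = detOn s B := by
  unfold detOn
  congr 1
  ext i j
  exact h i i.2 j j.2

/-- Gaussian elimination of the index `b`. -/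
theorem detOn_erase {s : Finset α} {A : Matrix α α K} {b : α} (hb : b ∈ s) (h : A b b ≠ 0) :
    detOn s A = A b b * detOn (s.erase b) (.of fun i j => A i j - A i b * A b j / A b b) := by
  -- The index set is split into `b` and the rest, so that the right side is the Schur complement of
  -- a 1 × 1 block.
  have hbij : Function.Bijective (Sum.elim (fun _ : Unit => (⟨b, hb⟩ : s))
      (fun i : s.erase b => ⟨i.1, Finset.mem_of_mem_erase i.2⟩)) := by
    constructor
    · rintro (⟨⟩ | ⟨i, hi⟩) (⟨⟩ | ⟨j, hj⟩) hij
      · rfl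
      · simp only [Sum.elim_inl, Sum.elim_inr, Subtype.mk.injEq] at hij
        exact absurd hij.symm (Finset.ne_of_mem_erase hj)
      · simp only [Sum.elim_inl, Sum.elim_inr, Subtype.mk.injEq] at hij
        exact absurd hij (Finset.ne_of_mem_erase hi)
      · simpa using hij
    · rintro ⟨i, hi⟩
      by_cases hib : i = b
      · exact ⟨Sum.inl (), by simp [hib]⟩
      · exact ⟨Sum.inr ⟨i, Finset.mem_erase.2 ⟨hib, hi⟩⟩, by simp⟩
  let e := Equiv.ofBijective _ hbij
  have : Invertible (Matrix.of fun _ _ : Unit => A b b) :=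
    Matrix.invertibleOfIsUnitDet _ (by simpa using h)
  have hinv : ⅟(Matrix.of fun _ _ : Unit => A b b) = Matrix.of fun _ _ : Unit => (A b b)⁻¹ := by
    apply invOf_eq_right_inv
    ext
    simp [Matrix.mul_apply, h]
  have hblock : (A.submatrix (Subtype.val : s → α) Subtype.val).submatrix e e =
      Matrix.fromBlocks (Matrix.of fun _ _ : Unit => A b b)
        (Matrix.of fun (_ : Unit) (j : s.erase b) => A b j)
        (Matrix.of fun (i : s.erase b) (_ : Unit) => A i b)
        (Matrix.of fun (i j : s.erase b) => A i j) := by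
    ext (_ | i) (_ | j) <;> rfl
  unfold detOn
  rw [← Matrix.det_submatrix_equiv_self e, hblock, Matrix.det_fromBlocks₁₁, hinv]
  congr 1
  · simp
  · congr 1
    ext i j
    simp only [Matrix.sub_apply, Matrix.mul_apply, Finset.univ_unique, Finset.sum_singleton,
      Matrix.of_apply, Matrix.submatrix_apply]
    ring

theorem detOn_map (e : Perm α) (s : Finset α) (A : Matrix α α K) :
    detOn (s.map e.toEmbedding) A = detOn s (A.submatrix e e) := by
  have hbij : Function.Bijective (fun i : s =>
      (⟨e i, Finset.mem_map_of_mem e.toEmbedding i.2⟩ : (s.map e.toEmbedding : Finset α))) := by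
    constructor
    · intro i j hij
      exact Subtype.ext (e.injective (congrArg Subtype.val hij))
    · rintro ⟨i, hi⟩
      obtain ⟨j, hj, rfl⟩ := Finset.mem_map.1 hi
      exact ⟨⟨j, hj⟩, rfl⟩
  unfold detOn
  rw [← Matrix.det_submatrix_equiv_self (Equiv.ofBijective _ hbij)]
  rfl

/-- Stitching the head of `a` to the tail of `b`, on matrices; the result is called `a`. -/
def stitchMat (a b : α) (M : Matrix α α K) : Matrix α α K := fun i j =>
  if i = b ∨ j = b then 0
  else M i (if j = a then b else j) + M i a * M b (if j = a then b else j) / (1 - M b a)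

/-- The matrix `1 - M S`, where `S` is the matrix of the permutation `σ`. -/
def gluingMat (M : Matrix α α K) (σ : Perm α) : Matrix α α K :=
  fun i j => (if i = j then 1 else 0) - M i (σ.symm j)

/-- The determinant on `s` obtained by glueing the head of every `a` to the tail of `σ a`. -/
def permDet (M : Matrix α α K) (σ : Perm α) (s : Finset α) : K := detOn s (gluingMat M σ)

/-- The pivot at `b` is `1 - M b a` because `σ a = b`. Elimination makes the gluing bypass `b`: now
`a` is followed by `σ b`, and `b` is fixed. The column at `σ b`, formerly taken from column `b` of
`M`, is now taken from column `a`; this is the renaming of columns built into `stitchMat`. -/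
theorem permDet_stitch {M : Matrix α α K} {σ : Perm α} {s : Finset α} {a b : α} (hab : a ≠ b)
    (hσ : σ a = b) (hb : b ∈ s) (hM : M b a ≠ 1) :
    permDet M σ s =
      (1 - M b a) * permDet (stitchMat a b M) (swap b (σ b) * σ) (s.erase b) := by
  have hσ' : σ.symm b = a := by rw [← hσ, Equiv.symm_apply_apply]
  have hbb : gluingMat M σ b b = 1 - M b a := by simp [gluingMat, hσ']
  have h1 : 1 - M b a ≠ 0 := sub_ne_zero.2 (Ne.symm hM)
  unfold permDet
  rw [detOn_erase hb (by rwa [hbb]), hbb]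
  congr 1
  apply detOn_congr
  intro i hi j hj
  have hi : i ≠ b := Finset.ne_of_mem_erase hi
  have hj : j ≠ b := Finset.ne_of_mem_erase hj
  have key : (swap b (σ b) * σ).symm j = if j = σ b then a else σ.symm j := by
    rw [Equiv.symm_apply_eq]
    split_ifs with h
    · simp [hσ, h]
    · simp [swap_apply_of_ne_of_ne hj h]
  -- Since `a ≠ b`, the strand `b` is not closed up on itself, so there is a genuine successor to
  -- bypass to.
  have hne : σ b ≠ b := fun h => hab (σ.injective (by rw [hσ, h]))
  have ha : σ.symm j ≠ a := fun h => hj (by rw [← hσ, ← h, Equiv.apply_symm_apply])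
  simp only [Matrix.of_apply, gluingMat, stitchMat, key, hσ', if_neg (Ne.symm hj)]
  by_cases h : j = σ b
  · simp [h, hab, hi]
    ring
  · have h' : σ.symm j ≠ b := fun h' => h (by rw [← h', Equiv.apply_symm_apply])
    simp [h, ha, h', hi]
    ring

theorem permDet_conj (e : Perm α) (M : Matrix α α K) (σ : Perm α) (s : Finset α) :
    permDet M (e * σ * e⁻¹) (s.map e.toEmbedding) = permDet (M.submatrix e e) σ s := by
  unfold permDet
  rw [detOn_map]
  apply detOn_congr
  intro i _ j _
  have : (e * σ * e⁻¹).symm (e j) = e (σ.symm j) := by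
    rw [Equiv.symm_apply_eq]; simp
  simp [gluingMat, this]

theorem permDet_congr {M N : Matrix α α K} {σ : Perm α} {s : Finset α}
    (hσ : ∀ i ∈ s, σ.symm i ∈ s) (h : ∀ i ∈ s, ∀ j ∈ s, M i j = N i j) :
    permDet M σ s = permDet N σ s := by
  apply detOn_congr
  intro i hi j hj
  simp [gluingMat, h i hi _ (hσ j hj)]

/-- The strand `x` passes through no crossing. -/
def IsTrivialAt (M : Matrix α α K) (x : α) : Prop :=
  ∀ j, M x j = (if x = j then 1 else 0) ∧ M j x = (if x = j then 1 else 0)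

/-- Here `γ = 0`, and row `x` is a unit vector: the correction term vanishes in all columns except
the renamed one, where it restores the entry `M i a`. -/
theorem stitchMat_of_isTrivialAt {M : Matrix α α K} {a x i j : α} (hax : a ≠ x)
    (hx : IsTrivialAt M x) (hi : i ≠ x) (hj : j ≠ x) : stitchMat a x M i j = M i j := by
  by_cases h : j = a
  · simp [stitchMat, hi, h, (hx _).1, (hx _).2, hax.symm, hi.symm, hax]
  · simp [stitchMat, hi, hj, h, (hx _).1, hax.symm, hj.symm]

end LinearAlgebra

/-! ### Permutations given by cyclic words -/

section Words

variable {α : Type*} [DecidableEq α]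

/-- The permutation that sends every letter of the cyclic words `cs` to the next one. -/
def wordPerm (cs : List (List α)) : Perm α := (cs.map List.formPerm).prod

@[simp] theorem wordPerm_nil : wordPerm ([] : List (List α)) = 1 := rfl

@[simp] theorem wordPerm_cons (w : List α) (cs : List (List α)) :
    wordPerm (w :: cs) = w.formPerm * wordPerm cs := by
  simp [wordPerm]

theorem wordPerm_apply_of_notMem {cs : List (List α)} {x : α} (hx : x ∉ cs.flatten) :
    wordPerm cs x = x := by
  induction cs with
  | nil => rfl
  | cons w cs ih =>
    simp only [List.flatten_cons, List.mem_append, not_or] at hx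
    rw [wordPerm_cons, Perm.mul_apply, ih hx.2, List.formPerm_apply_of_notMem hx.1]

theorem wordPerm_mem_iff {cs : List (List α)} {x : α} :
    wordPerm cs x ∈ cs.flatten ↔ x ∈ cs.flatten := by
  constructor
  · intro h
    by_contra hx
    rw [wordPerm_apply_of_notMem hx] at h
    exact hx h
  · intro h
    by_contra hx
    have := wordPerm_apply_of_notMem hx
    rw [(wordPerm cs).injective this] at hx
    exact hx h

theorem commute_formPerm {v w : List α} (h : v.Disjoint w) :
    Commute v.formPerm w.formPerm := by
  apply Perm.Disjoint.commute
  intro x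
  by_cases hx : x ∈ v
  · exact Or.inr (List.formPerm_apply_of_notMem (h hx))
  · exact Or.inl (List.formPerm_apply_of_notMem hx)

theorem wordPerm_eq_of_perm {cs cs' : List (List α)} (hn : cs.flatten.Nodup) (h : cs.Perm cs') :
    wordPerm cs = wordPerm cs' := by
  apply (h.map _).prod_eq'
  rw [List.pairwise_map]
  exact (List.nodup_flatten.1 hn).2.imp fun h => commute_formPerm h

theorem wordPerm_apply {cs : List (List α)} (hn : cs.flatten.Nodup) {w : List α} (hw : w ∈ cs)
    {x : α} (hx : x ∈ w) : wordPerm cs x = w.formPerm x := by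
  have hp := List.perm_cons_erase hw
  have hn' := hp.flatten.nodup_iff.1 hn
  rw [wordPerm_eq_of_perm hn hp, wordPerm_cons, Perm.mul_apply, wordPerm_apply_of_notMem]
  simp only [List.flatten_cons] at hn'
  exact (List.nodup_append'.1 hn').2.2 hx

theorem formPerm_apply_of_infix {w : List α} (hw : w.Nodup) {a b : α} (h : [a, b] <:+: w) :
    w.formPerm a = b := by
  obtain ⟨u, v, rfl⟩ := h
  have hr : (u ++ [a, b] ++ v) ~r (a :: b :: (v ++ u)) := by
    simpa using List.isRotated_append (l := u) (l' := [a, b] ++ v)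
  rw [List.formPerm_eq_of_isRotated hw hr,
    List.formPerm_apply_head _ _ _ (hr.perm.nodup_iff.1 hw)]

theorem wordPerm_apply_of_infix {cs : List (List α)} (hn : cs.flatten.Nodup) {w : List α}
    (hw : w ∈ cs) {a b : α} (h : [a, b] <:+: w) : wordPerm cs a = b := by
  rw [wordPerm_apply hn hw (h.subset (by simp)),
    formPerm_apply_of_infix ((List.nodup_flatten.1 hn).1 w hw) h]

/-- Without `x`, its predecessor goes directly to its successor, which is the effect of composing
with the transposition of `x` and its successor. If `x` is absent or alone, that transposition is
the identity. -/
theorem formPerm_filter {w : List α} (hw : w.Nodup) (x : α) :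
    (w.filter (fun y => y ≠ x)).formPerm = swap x (w.formPerm x) * w.formPerm := by
  by_cases hx : x ∈ w
  · obtain ⟨u, v, rfl⟩ := List.append_of_mem hx
    have hr : (u ++ x :: v) ~r (x :: (v ++ u)) := by
      simpa using List.isRotated_append (l := u) (l' := x :: v)
    have hn := hr.perm.nodup_iff.1 hw
    have hx' : x ∉ v ++ u := (List.nodup_cons.1 hn).1
    have hf : (u ++ x :: v).filter (fun y => y ≠ x) = u ++ v := by
      simp only [List.mem_append, not_or] at hx'
      have h1 : u.filter (fun y => y ≠ x) = u :=
        List.filter_eq_self.2 fun y hy => by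
          simpa using fun h : y = x => hx'.2 (h ▸ hy)
      have h2 : v.filter (fun y => y ≠ x) = v :=
        List.filter_eq_self.2 fun y hy => by
          simpa using fun h : y = x => hx'.1 (h ▸ hy)
      rw [List.filter_append, h1, List.filter_cons_of_neg (by simp), h2]
    have hr' : (u ++ v) ~r (v ++ u) := List.isRotated_append
    rw [hf, List.formPerm_eq_of_isRotated (hr'.perm.nodup_iff.2 (List.nodup_cons.1 hn).2) hr',
      List.formPerm_eq_of_isRotated hw hr]
    rcases hvu : v ++ u with _ | ⟨y, r⟩
    · simp [← Perm.one_def]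
    · rw [hvu] at hn
      rw [List.formPerm_apply_head _ _ _ hn, List.formPerm_cons_cons, ← mul_assoc,
        Equiv.swap_mul_self, one_mul]
  · rw [List.formPerm_apply_of_notMem hx, Equiv.swap_self, List.filter_eq_self.2]
    · rfl
    · intro y hy
      simpa using fun h : y = x => hx (h ▸ hy)

/-- Omit the letter `x` from all words. -/
def eraseLetter (x : α) (cs : List (List α)) : List (List α) :=
  cs.map (List.filter fun y => y ≠ x)

theorem flatten_eraseLetter (x : α) (cs : List (List α)) :
    (eraseLetter x cs).flatten = cs.flatten.filter fun y => y ≠ x := by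
  simp [eraseLetter, List.filter_flatten]

theorem nodup_eraseLetter {x : α} {cs : List (List α)} (hn : cs.flatten.Nodup) :
    (eraseLetter x cs).flatten.Nodup := by
  rw [flatten_eraseLetter]
  exact hn.filter _

theorem wordPerm_eraseLetter {cs : List (List α)} (hn : cs.flatten.Nodup) (x : α) :
    wordPerm (eraseLetter x cs) = swap x (wordPerm cs x) * wordPerm cs := by
  induction cs with
  | nil => simp [eraseLetter]; rfl
  | cons w cs ih =>
    rw [List.flatten_cons, List.nodup_append'] at hn
    have ih := ih hn.2.1
    simp only [eraseLetter, List.map_cons, wordPerm_cons] at ih ⊢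
    rw [ih, formPerm_filter hn.1]
    by_cases hx : x ∈ w
    · have hx' : x ∉ cs.flatten := hn.2.2 hx
      simp [wordPerm_apply_of_notMem hx', mul_assoc, ← Perm.one_def]
    · rw [List.formPerm_apply_of_notMem hx, Equiv.swap_self]
      by_cases hx' : x ∈ cs.flatten
      · have h1 : wordPerm cs x ∉ w := fun h => hn.2.2 h (wordPerm_mem_iff.2 hx')
        rw [Perm.mul_apply, List.formPerm_apply_of_notMem h1]
        -- Both letters of the transposition lie in the other words, so `w.formPerm` fixes them.
        have : w.formPerm * swap x (wordPerm cs x) = swap x (wordPerm cs x) * w.formPerm := by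
          rw [Equiv.mul_swap_eq_swap_mul, List.formPerm_apply_of_notMem hx,
            List.formPerm_apply_of_notMem h1]
        rw [← mul_assoc, ← mul_assoc, ← this]
        rfl
      · rw [Perm.mul_apply, wordPerm_apply_of_notMem hx', List.formPerm_apply_of_notMem hx,
          Equiv.swap_self]
        rfl

theorem wordPerm_map (e : Perm α) (cs : List (List α)) :
    wordPerm (cs.map (List.map e)) = e * wordPerm cs * e⁻¹ := by
  have h1 : ∀ l : List α, (l.map e).formPerm = e * l.formPerm * e⁻¹ := by
    intro l
    induction l with
    | nil => simp
    | cons x l ih =>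
      cases l with
      | nil => simp
      | cons y l =>
        simp only [List.map_cons, List.formPerm_cons_cons] at ih ⊢
        rw [ih]
        have : swap (e x) (e y) = e * swap x y * e⁻¹ := by
          rw [Equiv.mul_swap_eq_swap_mul, mul_assoc, mul_inv_cancel, mul_one]
        rw [this]
        group
  induction cs with
  | nil => simp
  | cons w cs ih =>
    simp only [List.map_cons, wordPerm_cons, ih, h1]
    group

/-- `formPerm` is the product of the transpositions of neighbouring letters, and this product can be
cut at any letter, which then belongs to both factors. -/
theorem formPerm_append_cons (l₁ l₂ : List α) (p : α) :
    (l₁ ++ p :: l₂).formPerm = (l₁ ++ [p]).formPerm * (p :: l₂).formPerm := by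
  induction l₁ with
  | nil => simp
  | cons x l ih =>
    cases l with
    | nil => simp
    | cons y l =>
      simp only [List.cons_append, List.formPerm_cons_cons] at ih ⊢
      rw [ih, mul_assoc]

/-- Exchanging the successors of two letters splits a cycle. -/
theorem formPerm_split {p q : α} {v x : List α} (hn : (p :: v ++ q :: x).Nodup) :
    (p :: v ++ q :: x).formPerm * swap p q = (q :: v).formPerm * (p :: x).formPerm := by
  have hn1 : (p :: v ++ [q]).Nodup :=
    hn.sublist (List.Sublist.append_left (by simp) _)
  have hn1' : (v ++ [q]).Nodup := (List.nodup_cons.1 hn1).2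
  -- Rotating `p` to the end lets the last transposition be split off on the right.
  have h1 : (p :: v ++ [q]).formPerm = (q :: v).formPerm * swap p q := by
    have hr : (p :: v ++ [q]) ~r (v ++ [q, p]) := by
      simpa using List.isRotated_append (l := [p]) (l' := v ++ [q])
    have hr' : (v ++ [q]) ~r (q :: v) := by
      simpa using List.isRotated_append (l := v) (l' := [q])
    rw [List.formPerm_eq_of_isRotated hn1 hr, List.formPerm_append_pair,
      List.formPerm_eq_of_isRotated hn1' hr', swap_comm]
  have hn2 : (p :: q :: x).Nodup :=
    hn.sublist ((List.Sublist.append_right (by simp : [p].Sublist (p :: v)) (q :: x)))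
  have hn3 : (p :: x).Nodup := hn2.sublist (by simp)
  -- This is conjugation by the transposition: in the cycle through `q` and `x`, the letter `q` is
  -- replaced by `p`.
  have h2 : swap p q * (q :: x).formPerm * swap p q = (p :: x).formPerm := by
    rw [← List.formPerm_cons_cons]
    have hr : (p :: q :: x) ~r (x ++ [p, q]) := by
      simpa using List.isRotated_append (l := [p, q]) (l' := x)
    have hr' : (x ++ [p]) ~r (p :: x) := by
      simpa using List.isRotated_append (l := x) (l' := [p])
    rw [List.formPerm_eq_of_isRotated hn2 hr, List.formPerm_append_pair,
      List.formPerm_eq_of_isRotated (hr'.perm.nodup_iff.2 hn3) hr', mul_assoc,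
      Equiv.swap_mul_self, mul_one]
  rw [formPerm_append_cons, h1, mul_assoc, mul_assoc, ← mul_assoc (swap p q), h2]

end Words

/-! ### The determinant of a gluing along cyclic words -/

section WordDet

variable {α : Type*} [DecidableEq α] {K : Type*} [Field K]

/-- The determinant obtained by glueing the strands along the cyclic words `cs`. -/
def wordDet (M : Matrix α α K) (cs : List (List α)) : K :=
  permDet M (wordPerm cs) cs.flatten.toFinset

theorem wordDet_congr {M N : Matrix α α K} {cs : List (List α)}
    (h : ∀ i ∈ cs.flatten, ∀ j ∈ cs.flatten, M i j = N i j) : wordDet M cs = wordDet N cs := by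
  apply permDet_congr
  · intro i hi
    rw [List.mem_toFinset] at hi ⊢
    rwa [← wordPerm_mem_iff, Equiv.apply_symm_apply]
  · simpa only [List.mem_toFinset] using h

theorem wordDet_eq_of_perm {M : Matrix α α K} {cs cs' : List (List α)} (hn : cs.flatten.Nodup)
    (h : cs.Perm cs') : wordDet M cs = wordDet M cs' := by
  unfold wordDet
  rw [wordPerm_eq_of_perm hn h, List.toFinset_eq_of_perm _ _ h.flatten]

theorem wordDet_eq_of_isRotated {M : Matrix α α K} {w w' : List α} {cs : List (List α)}
    (hn : w.Nodup) (h : w ~r w') : wordDet M (w :: cs) = wordDet M (w' :: cs) := by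
  unfold wordDet
  rw [wordPerm_cons, wordPerm_cons, List.formPerm_eq_of_isRotated hn h,
    List.toFinset_eq_of_perm (w :: cs).flatten (w' :: cs).flatten
      (by simpa using h.perm.append_right cs.flatten)]

theorem wordDet_map (e : Perm α) (M : Matrix α α K) (cs : List (List α)) :
    wordDet M (cs.map (List.map e)) = wordDet (M.submatrix e e) cs := by
  unfold wordDet
  rw [wordPerm_map, ← permDet_conj]
  congr 1
  ext x
  simp only [← List.map_flatten, List.mem_toFinset, List.mem_map, Finset.mem_map]
  rfl

theorem toFinset_eraseLetter (x : α) (cs : List (List α)) :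
    (eraseLetter x cs).flatten.toFinset = cs.flatten.toFinset.erase x := by
  ext y
  rw [flatten_eraseLetter, List.mem_toFinset, List.mem_filter, Finset.mem_erase,
    List.mem_toFinset, and_comm]
  simp

theorem wordDet_stitch {M : Matrix α α K} {cs : List (List α)} (hn : cs.flatten.Nodup) {a b : α}
    (hab : a ≠ b) (h : wordPerm cs a = b) (hM : M b a ≠ 1) :
    wordDet M cs = (1 - M b a) * wordDet (stitchMat a b M) (eraseLetter b cs) := by
  have hb : b ∈ cs.flatten := by
    by_contra hb
    have := wordPerm_apply_of_notMem hb
    exact hab ((wordPerm cs).injective (h.trans this.symm))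
  unfold wordDet
  rw [permDet_stitch hab h (List.mem_toFinset.2 hb) hM, wordPerm_eraseLetter hn,
    toFinset_eraseLetter]

/-- A letter that is not alone in its word has a predecessor other than itself. Stitching the
trivial strand to this predecessor has pivot `1` and leaves all other entries unchanged. The word
`[x]` has to be excluded: it makes row `x` of `1 - M S` zero. -/
theorem wordDet_eraseLetter {M : Matrix α α K} {cs : List (List α)} (hn : cs.flatten.Nodup) {x : α}
    (hx : IsTrivialAt M x) (hcs : [x] ∉ cs) : wordDet M cs = wordDet M (eraseLetter x cs) := by
  by_cases hmem : x ∈ cs.flatten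
  · have hfix : wordPerm cs x ≠ x := by
      obtain ⟨w, hw, hxw⟩ := List.mem_flatten.1 hmem
      have hwn := (List.nodup_flatten.1 hn).1 w hw
      rw [wordPerm_apply hn hw hxw]
      intro h
      rw [List.formPerm_apply_mem_eq_self_iff _ hwn _ hxw] at h
      obtain ⟨y, rfl⟩ := List.length_eq_one_iff.1
        (le_antisymm h (List.length_pos_of_mem hxw))
      simp only [List.mem_singleton] at hxw
      exact hcs (hxw ▸ hw)
    obtain ⟨a, ha⟩ := (wordPerm cs).surjective x
    have hax : a ≠ x := by
      rintro rfl
      exact hfix ha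
    have h0 : M x a = 0 := by simp [(hx a).1, hax.symm]
    rw [wordDet_stitch hn hax ha (by simp [h0]), h0, sub_zero, one_mul]
    apply wordDet_congr
    intro i hi j hj
    rw [flatten_eraseLetter, List.mem_filter] at hi hj
    exact stitchMat_of_isTrivialAt hax hx (by simpa using hi.2) (by simpa using hj.2)
  · have : eraseLetter x cs = cs := by
      unfold eraseLetter
      rw [List.map_congr_left (g := id), List.map_id]
      intro w hw
      refine List.filter_eq_self.2 fun y hy => ?_
      simpa using fun h : y = x => hmem (h ▸ List.mem_flatten.2 ⟨w, hw, hy⟩)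
    rw [this]

end WordDet

/-! ### Substitutions in Gamma-calculus -/

/-- The substitution `t_i → 1`. -/
def evalOne : RegularFunction →+* ℚ :=
  IsLocalization.lift (M := denominators) (g := MvPolynomial.eval fun _ => (1 : ℚ))
    fun p => isUnit_iff_ne_zero.2 p.2

theorem evalOne_algebraMap (p : MvPolynomial Label ℚ) :
    evalOne (algebraMap _ RegularFunction p) = MvPolynomial.eval (fun _ => (1 : ℚ)) p :=
  IsLocalization.lift_eq _ _

/-- `RegularFunction` is the local ring at the point where all variables are `1`, so its units are
the elements not vanishing there. -/
theorem isUnit_of_evalOne_ne_zero {x : RegularFunction} (h : evalOne x ≠ 0) : IsUnit x := by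
  obtain ⟨⟨p, d⟩, hpd⟩ := IsLocalization.surj denominators x
  have hp : MvPolynomial.eval (fun _ => (1 : ℚ)) p ≠ 0 := by
    rw [← evalOne_algebraMap, ← hpd, map_mul, evalOne_algebraMap]
    exact mul_ne_zero h d.2
  have hu : IsUnit (algebraMap _ RegularFunction p) :=
    IsLocalization.map_units RegularFunction (⟨p, hp⟩ : denominators)
  simp only [← hpd] at hu
  exact isUnit_of_mul_isUnit_left hu

theorem specialize_algebraMap (p : MvPolynomial Label ℚ) :
    specialize (algebraMap _ RegularFunction p) =
      MvPolynomial.aeval (fun _ : Label => sqrtT ^ 2) p :=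
  IsLocalization.lift_eq _ _

theorem substVars_algebraMap (f : Label → Label) (p : MvPolynomial Label ℚ) :
    substVars f (algebraMap _ RegularFunction p) =
      algebraMap _ RegularFunction (MvPolynomial.rename f p) :=
  IsLocalization.map_eq _ _

/-- Once all variables are identified, renaming them is invisible. Hence the stitchings can be
followed over `ℚ(t^{1/2})` without keeping track of the variables. -/
theorem specialize_substVars (f : Label → Label) (x : RegularFunction) :
    specialize (substVars f x) = specialize x := by
  have : specialize.comp (substVars f) = specialize := by
    apply IsLocalization.ringHom_ext denominators
    ext x
    · simp
    · simp [substVars_algebraMap, specialize_algebraMap]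
  exact DFunLike.congr_fun this x

theorem evalOne_substVars (f : Label → Label) (x : RegularFunction) :
    evalOne (substVars f x) = evalOne x := by
  have : evalOne.comp (substVars f) = evalOne := by
    apply IsLocalization.ringHom_ext denominators
    ext x
    · simp
    · simp [substVars_algebraMap, evalOne_algebraMap]
  exact DFunLike.congr_fun this x

theorem map_tPow {R : Type*} [DivisionRing R] (f : RegularFunction →+* R) (a : Label) (ε : ℤˣ) :
    f (tPow a ε) = f (tVar a) ^ (ε : ℤ) := by
  have h : f (tPow a ε) = ((Units.map (f : RegularFunction →* R)
      ((isUnit_tVar a).unit ^ (ε : ℤ)) : Rˣ) : R) := rfl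
  rw [h, map_zpow, Units.val_zpow_eq_zpow_val]
  rfl

theorem evalOne_tPow (a : Label) (ε : ℤˣ) : evalOne (tPow a ε) = 1 := by
  rw [map_tPow, tVar, evalOne_algebraMap, MvPolynomial.eval_X, one_zpow]

theorem specialize_tPow (a : Label) (ε : ℤˣ) :
    specialize (tPow a ε) = (sqrtT ^ 2) ^ (ε : ℤ) := by
  rw [map_tPow, tVar, specialize_algebraMap, MvPolynomial.aeval_X]

/-- The matrix becomes diagonal for `t_i → 1`. -/
def Gamma.IsDiagonalAtOne (g : Gamma) : Prop := ∀ i j, i ≠ j → evalOne (g.mat i j) = 0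

/-- The matrix part with all variables identified. -/
def Gamma.specMat (g : Gamma) : Matrix Label Label (RatFunc ℚ) := g.mat.map specialize

namespace Gamma

variable {g : Gamma} {a b : Label}

/-- The entry `γ` is off the diagonal, so every pivot takes the value `1` at `t_i = 1`. -/
theorem IsDiagonalAtOne.isUnit (hg : g.IsDiagonalAtOne) (hab : a ≠ b) :
    IsUnit (1 - g.mat b a) :=
  isUnit_of_evalOne_ne_zero (by simp [hg b a hab.symm])

theorem IsDiagonalAtOne.specMat_ne_one (hg : g.IsDiagonalAtOne) (hab : a ≠ b) :
    g.specMat b a ≠ 1 := by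
  have := ((hg.isUnit hab).map specialize).ne_zero
  rw [map_sub, map_one] at this
  exact fun h => this (by rw [sub_eq_zero]; exact h.symm)

theorem specialize_stitch_scalar (a b : Label) (g : Gamma) :
    specialize (g.stitch a b a).scalar = (1 - g.specMat b a) * specialize g.scalar := by
  simp [stitch, specialize_substVars, specMat]

theorem specMat_stitch (hg : g.IsDiagonalAtOne) (hab : a ≠ b) :
    (g.stitch a b a).specMat = stitchMat a b g.specMat := by
  ext i j : 2
  have hinv : specialize (Ring.inverse (1 - g.mat b a)) = (1 - specialize (g.mat b a))⁻¹ := by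
    apply eq_inv_of_mul_eq_one_left
    rw [← map_one specialize, ← map_sub, ← map_mul, Ring.inverse_mul_cancel _ (hg.isUnit hab)]
  -- The result keeps the name `a`, so `b` is the only index removed.
  have hc : ∀ i : Label, (i ≠ a ∧ (i = a ∨ i = b)) ↔ i = b := by
    intro i
    constructor
    · tauto
    · rintro rfl
      exact ⟨hab.symm, Or.inr rfl⟩
  simp only [specMat, Matrix.map_apply, stitch, Matrix.of_apply, hc, stitchMat]
  split_ifs with h1 h2 h3 h3 <;> simp [specialize_substVars, div_eq_mul_inv, *]

/-- Off the diagonal of the new matrix, the old entry and one factor of the correction term are both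
off-diagonal in the old matrix, so they vanish at `t_i = 1`. Thus all later pivots remain units. -/
theorem IsDiagonalAtOne.stitch (hg : g.IsDiagonalAtOne) (hab : a ≠ b) :
    (g.stitch a b a).IsDiagonalAtOne := by
  intro i j hij
  have hc : ∀ i : Label, (i ≠ a ∧ (i = a ∨ i = b)) ↔ i = b := by
    intro i
    constructor
    · tauto
    · rintro rfl
      exact ⟨hab.symm, Or.inr rfl⟩
  simp only [Gamma.stitch, Matrix.of_apply, hc]
  split_ifs with h1 h2 h3 h3
  · simp
  · exact absurd (h2.trans h3.symm) hij
  · simp only [not_or] at h1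
    rw [evalOne_substVars, map_add, map_mul, map_mul, hg a j (Ne.symm h3), hg b j (Ne.symm h1.2)]
    simp
  · simp only [not_or] at h1
    rw [evalOne_substVars, map_add, map_mul, map_mul, hg i b h1.1, hg i a h2]
    simp
  · rw [evalOne_substVars, map_add, map_mul, map_mul, hg i j hij, hg i a h2]
    simp

theorem IsDiagonalAtOne.addTrivial (hg : g.IsDiagonalAtOne) (a : Label) :
    (g.addTrivial a).IsDiagonalAtOne := by
  intro i j hij
  have : Matrix.single a a (1 : RegularFunction) i j = 0 := by
    rw [Matrix.single_apply, if_neg]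
    rintro ⟨rfl, h⟩
    exact hij h
  simp [Gamma.addTrivial, hg i j hij, this]

end Gamma

/-! ### The trace invariant as a determinant -/

/-- The cyclic words of labels along which the strands are glued: each component starts with a
trivial strand `comp n`, `comp (n + 1)`, …. -/
def baseWords : ℕ → List (List Letter) → List (List Label)
  | _, [] => []
  | n, w :: ws => (Label.comp n :: w.map Letter.label) :: baseWords (n + 1) ws

theorem flatten_baseWords_perm (n : ℕ) (ws : List (List Letter)) :
    (baseWords n ws).flatten.Perm
      ((List.range' n ws.length).map Label.comp ++ ws.flatten.map Letter.label) := by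
  induction ws generalizing n with
  | nil => simp [baseWords]
  | cons w ws ih =>
    simp only [baseWords, List.flatten_cons, List.length_cons, List.range'_succ, List.map_cons,
      List.map_append, List.cons_append]
    refine List.Perm.cons _ ?_
    refine (List.Perm.append_left _ (ih (n + 1))).trans ?_
    rw [← List.append_assoc, ← List.append_assoc]
    exact List.Perm.append_right _ List.perm_append_comm

theorem Letter.label_ne_comp (p : Letter) (n : ℕ) : p.label ≠ Label.comp n := by
  unfold Letter.label
  split_ifs <;> simp

theorem Letter.label_eq_label_iff {p q : Letter} :
    p.label = q.label ↔ p.crossing = q.crossing ∧ p.isOver = q.isOver := by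
  rcases p with ⟨c, ε, _ | _⟩ <;> rcases q with ⟨c', ε', _ | _⟩ <;> simp [Letter.label]

theorem nodup_map_label_iff {w : List Letter} :
    (w.map Letter.label).Nodup ↔ (w.map fun p => (p.crossing, p.isOver)).Nodup := by
  unfold List.Nodup
  rw [List.pairwise_map, List.pairwise_map]
  simp only [ne_eq, Letter.label_eq_label_iff, Prod.mk.injEq]

theorem nodup_baseWords_iff {n : ℕ} {ws : List (List Letter)} :
    (baseWords n ws).flatten.Nodup ↔ (ws.flatten.map Letter.label).Nodup := by
  rw [(flatten_baseWords_perm n ws).nodup_iff, List.nodup_append']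
  constructor
  · exact fun h => h.2.1
  · refine fun h => ⟨?_, h, ?_⟩
    · refine List.Nodup.map ?_ List.nodup_range'
      intro i j hij
      simpa using hij
    · intro x hx hx'
      obtain ⟨m, _, rfl⟩ := List.mem_map.1 hx
      obtain ⟨p, _, hp⟩ := List.mem_map.1 hx'
      exact p.label_ne_comp m hp

/-- The diagonal entries of the trivial strands `comp n`, `comp (n + 1)`, …. -/
def freeEntry (n : ℕ) : Label → RatFunc ℚ
  | Label.comp m => if n ≤ m then 1 else 0
  | _ => 0

theorem freeEntry_of_ne_comp {n : ℕ} {p : Label} (hp : ∀ k, p ≠ Label.comp k) :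
    freeEntry n p = 0 := by
  cases p with
  | comp k => exact absurd rfl (hp k)
  | _ => rfl

/-- The matrix of `g` with all variables identified, extended by trivial strands
`comp n`, `comp (n + 1)`, …; the row of the open component `comp 0` is deleted. -/
def Gamma.augment (n : ℕ) (g : Gamma) : Matrix Label Label (RatFunc ℚ) := fun i j =>
  if i = Label.comp 0 then 0 else g.specMat i j + if i = j then freeEntry n i else 0

/-- The scalar obtained from `g` by glueing along the cyclic words `cs`. -/
def Gamma.value (n : ℕ) (g : Gamma) (cs : List (List Label)) : RatFunc ℚ :=
  specialize g.scalar * wordDet (g.augment n) cs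

namespace Gamma

/-- Trivial strands not yet added are already counted by `freeEntry`; adding `comp n` only moves its
diagonal entry into the matrix proper. -/
theorem value_addTrivial (n : ℕ) (g : Gamma) (cs : List (List Label)) :
    (g.addTrivial (Label.comp n)).value (n + 1) cs = g.value n cs := by
  have : (g.addTrivial (Label.comp n)).augment (n + 1) = g.augment n := by
    ext i j : 2
    simp only [augment, addTrivial, specMat, Matrix.map_apply, Matrix.add_apply, map_add,
      add_assoc]
    congr 2
    by_cases hij : i = j
    · subst hij
      cases i with
      | comp m =>
        simp only [if_true, freeEntry, Matrix.single_apply, Label.comp.injEq, and_self]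
        rcases lt_trichotomy n m with h | h | h
        · simp [h.ne, h.le, Nat.succ_le_of_lt h]
        · simp [h]
        · simp [h.ne', h.not_ge, (Nat.lt_succ_of_lt h).not_ge]
      | _ => simp [freeEntry]
    · have : Matrix.single (Label.comp n) (Label.comp n) (1 : RegularFunction) i j = 0 := by
        rw [Matrix.single_apply, if_neg]
        rintro ⟨rfl, h⟩
        exact hij h
      simp [this, hij]
  rw [value, this]
  rfl

/-- Deleting the row of `comp 0` commutes with stitching, because row `i` of the result is a
multiple of entries of row `i` and `γ` comes from row `p`, which is not deleted. The bound `m < n`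
ensures that `comp m` no longer carries a free diagonal entry. -/
theorem augment_stitch {g : Gamma} (hg : g.IsDiagonalAtOne) {n m : ℕ} (hm : m < n) {p : Label}
    (hp : ∀ k, p ≠ Label.comp k) :
    (g.stitch (Label.comp m) p (Label.comp m)).augment n =
      stitchMat (Label.comp m) p (g.augment n) := by
  have hmp : Label.comp m ≠ p := (hp m).symm
  have hd : freeEntry n p = 0 := freeEntry_of_ne_comp hp
  have hd' : freeEntry n (Label.comp m) = 0 := if_neg hm.not_ge
  ext i j : 2
  rw [augment, specMat_stitch hg hmp]
  simp only [stitchMat, augment, if_neg (hp 0), hd, ite_self, add_zero]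
  by_cases hi0 : i = Label.comp 0
  · simp [hi0]
  by_cases hi : i = p
  · simp [hi, hd]
  by_cases hj : j = p
  · simp [hi0, hi, hj]
  by_cases hjm : j = Label.comp m
  · by_cases him : i = Label.comp m
    · subst him
      have hm0 : m ≠ 0 := fun h => hi0 (by rw [h])
      simp [hm0, hjm, hmp, hd']
    · simp [hi0, hi, hjm, hmp, him]
  · by_cases him : i = Label.comp m
    · subst him
      simp only [hi0, hj, hjm, hd', hmp, ite_self, or_self, if_false, add_zero]
    · simp only [hi0, hi, hj, hjm, him, or_self, if_false, add_zero]
      ring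

/-- The pivot leaving the determinant is the factor that enters the scalar part, so the product is
preserved. -/
theorem value_stitch {g : Gamma} (hg : g.IsDiagonalAtOne) {n m : ℕ} (hm : m < n) {p : Label}
    (hp : ∀ k, p ≠ Label.comp k) {w : List Label} {cs : List (List Label)}
    (hn : ((Label.comp m :: p :: w) :: cs).flatten.Nodup) :
    (g.stitch (Label.comp m) p (Label.comp m)).value n ((Label.comp m :: w) :: cs) =
      g.value n ((Label.comp m :: p :: w) :: cs) := by
  have hmp : Label.comp m ≠ p := (hp m).symm
  have hval : g.augment n p (Label.comp m) = g.specMat p (Label.comp m) := by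
    simp [augment, hp]
  have he : eraseLetter p ((Label.comp m :: p :: w) :: cs) = (Label.comp m :: w) :: cs := by
    have hpw : p ∉ w ∧ p ∉ cs.flatten := by
      simp only [List.flatten_cons, List.cons_append, List.nodup_cons] at hn
      simpa using hn.2.1
    simp only [eraseLetter, List.map_cons]
    rw [List.filter_cons_of_pos (by simpa using hmp), List.filter_cons_of_neg (by simp),
      List.filter_eq_self.2, List.map_congr_left (g := id), List.map_id]
    · intro v hv
      refine List.filter_eq_self.2 fun y hy => ?_
      simpa using fun h : y = p => hpw.2 (h ▸ List.mem_flatten.2 ⟨v, hv, hy⟩)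
    · intro y hy
      simpa using fun h : y = p => hpw.1 (h ▸ hy)
  have hperm : wordPerm ((Label.comp m :: p :: w) :: cs) (Label.comp m) = p :=
    wordPerm_apply_of_infix hn (w := Label.comp m :: p :: w) (by simp) ⟨[], w, by simp⟩
  rw [value, value, wordDet_stitch hn hmp hperm (by rw [hval]; exact hg.specMat_ne_one hmp), he,
    hval, specialize_stitch_scalar, augment_stitch hg hm hp]
  ring

theorem value_stitchWord {n m : ℕ} (hm : m < n) (w : List Letter) {cs : List (List Label)}
    {g : Gamma} (hg : g.IsDiagonalAtOne)
    (hn : ((Label.comp m :: w.map Letter.label) :: cs).flatten.Nodup) :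
    (stitchWord (Label.comp m) w g).IsDiagonalAtOne ∧
    (stitchWord (Label.comp m) w g).value n ([Label.comp m] :: cs) =
      g.value n ((Label.comp m :: w.map Letter.label) :: cs) := by
  induction w generalizing g with
  | nil => exact ⟨hg, rfl⟩
  | cons p w ih =>
    have hn' : ((Label.comp m :: w.map Letter.label) :: cs).flatten.Nodup := by
      refine hn.sublist ?_
      simp
    obtain ⟨h1, h2⟩ := ih (hg.stitch (p.label_ne_comp m).symm) hn'
    exact ⟨h1, h2.trans (value_stitch hg hm p.label_ne_comp hn)⟩

theorem flatten_baseWords_replicate_sublist (n : ℕ) (ws : List (List Letter)) :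
    (baseWords n (List.replicate ws.length [])).flatten.Sublist (baseWords n ws).flatten := by
  induction ws generalizing n with
  | nil => simp [baseWords]
  | cons w ws ih =>
    simp only [List.length_cons, List.replicate_succ, baseWords, List.flatten_cons, List.map_nil,
      List.cons_append]
    exact ((List.nil_sublist _).append (ih (n + 1))).cons_cons _

theorem value_eq_of_perm {n : ℕ} {g : Gamma} {cs cs' : List (List Label)}
    (hn : cs.flatten.Nodup) (h : cs.Perm cs') : g.value n cs = g.value n cs' := by
  rw [value, value, wordDet_eq_of_perm hn h]

/-- The words `cs` hold the components already completed, each reduced to its base point. They are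
carried along because the determinant involves all components at once. -/
theorem value_stitchWords (ws : List (List Letter)) {n : ℕ} {cs : List (List Label)}
    {g : Gamma} (hg : g.IsDiagonalAtOne) (hn : (baseWords n ws ++ cs).flatten.Nodup) :
    (stitchWords n ws g).value (n + ws.length)
      (baseWords n (List.replicate ws.length []) ++ cs) = g.value n (baseWords n ws ++ cs) := by
  induction ws generalizing n cs g with
  | nil => rfl
  | cons w ws ih =>
    simp only [stitchWords, List.length_cons, List.replicate_succ, baseWords, List.map_nil,
      List.cons_append] at hn ⊢
    obtain ⟨h1, h2⟩ := value_stitchWord (Nat.lt_succ_self n) w (hg.addTrivial (Label.comp n)) hn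
    rw [value_addTrivial] at h2
    have hn1 : ([Label.comp n] :: (baseWords (n + 1) ws ++ cs)).flatten.Nodup := by
      refine hn.sublist ?_
      simp
    have hn2 : (baseWords (n + 1) ws ++ [Label.comp n] :: cs).flatten.Nodup :=
      (List.perm_middle.flatten.nodup_iff).2 hn1
    have h3 := ih h1 hn2
    rw [← h2, value_eq_of_perm hn1 List.perm_middle.symm, ← h3, ← add_assoc, add_right_comm]
    refine (value_eq_of_perm ?_ List.perm_middle).symm
    rw [List.perm_middle.flatten.nodup_iff]
    refine List.Nodup.sublist ?_ hn1
    simp only [List.flatten_cons, List.flatten_append]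
    exact (List.Sublist.refl _).append
      ((flatten_baseWords_replicate_sublist _ _).append (List.Sublist.refl _))

theorem wordPerm_baseWords_replicate (n k : ℕ) :
    wordPerm (baseWords n (List.replicate k [])) = 1 := by
  induction k generalizing n with
  | zero => rfl
  | succ k ih => simp [List.replicate_succ, baseWords, ih]

/-- When every component is a single strand, the gluing is the identity permutation and the
determinant is that of `1 - M` on `comp 0, …, comp k`. The deleted row makes row `comp 0` a unit
vector, so eliminating it leaves `1 - α`. -/
theorem value_components (g : Gamma) (k : ℕ) :
    g.value (k + 1) (baseWords 0 (List.replicate (k + 1) [])) = specialize (g.trace k) := by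
  rw [value, trace, map_mul]
  congr 1
  have hmem : ∀ x, x ∈ (baseWords 0 (List.replicate (k + 1) [])).flatten.toFinset ↔
      ∃ m < k + 1, x = Label.comp m := by
    intro x
    rw [List.mem_toFinset, (flatten_baseWords_perm _ _).mem_iff]
    simp [eq_comm]
  rw [wordDet, wordPerm_baseWords_replicate, permDet,
    detOn_erase (b := Label.comp 0) ((hmem _).2 ⟨0, by simp, rfl⟩) (by simp [gluingMat, augment])]
  have h00 : gluingMat (g.augment (k + 1)) 1 (Label.comp 0) (Label.comp 0) = 1 := by
    simp [gluingMat, augment]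
  have hbij : Function.Bijective (fun i : Fin k =>
      (⟨Label.comp (i + 1), Finset.mem_erase.2 ⟨by simp, (hmem _).2 ⟨i + 1, by omega, rfl⟩⟩⟩ :
        ((baseWords 0 (List.replicate (k + 1) [])).flatten.toFinset.erase (Label.comp 0) :
          Finset Label))) := by
    constructor
    · intro i j hij
      simpa [Fin.ext_iff] using hij
    · rintro ⟨i, hi⟩
      obtain ⟨hi0, hi⟩ := Finset.mem_erase.1 hi
      obtain ⟨m, hm, rfl⟩ := (hmem _).1 hi
      have hm0 : m ≠ 0 := fun h => hi0 (by rw [h])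
      refine ⟨⟨m - 1, by omega⟩, ?_⟩
      simp only [Subtype.mk.injEq, Label.comp.injEq]
      omega
  rw [h00, one_mul]
  unfold detOn
  rw [← Matrix.det_submatrix_equiv_self (Equiv.ofBijective _ hbij),
    RingHom.map_det]
  congr 1
  ext i j
  have h1 : gluingMat (g.augment (k + 1)) 1 (Label.comp 0) (Label.comp (j + 1)) = 0 := by
    simp [gluingMat, augment]
  have hi : ¬ k + 1 ≤ (i : ℕ) + 1 := by omega
  have h2 : ∀ x, (Equiv.symm (1 : Perm Label)) x = x := fun _ => rfl
  simp only [Matrix.submatrix_apply, Equiv.ofBijective_apply, RingHom.mapMatrix_apply,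
    Matrix.map_apply, Matrix.sub_apply, map_sub, Matrix.of_apply]
  rw [h1, mul_zero, zero_div, sub_zero, gluingMat]
  simp [augment, specMat, freeEntry, hi, h2, Matrix.one_apply, Fin.ext_iff, apply_ite specialize]

end Gamma

/-! ### The matrix of a diagram -/

/-- The matrix of the crossings, where `τ c` is `t` to the sign of the crossing `c`; the strands
`comp n` with `n > 0` are trivial, and the row of the open component `comp 0` is deleted. -/
def crossingMat {K : Type*} [Field K] (τ : ℕ → K) : Matrix Label Label K
  | Label.over c, Label.over d => if c = d then 1 else 0
  | Label.over c, Label.under d => if c = d then 1 - τ c else 0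
  | Label.under c, Label.under d => if c = d then τ c else 0
  | Label.comp m, Label.comp n => if m = n ∧ m ≠ 0 then 1 else 0
  | _, _ => 0

/-- The disjoint union of the crossings whose over-passages are listed in `w`. -/
def crossingUnion (w : List Letter) : Gamma :=
  (w.map fun p => Gamma.crossing p.sign (Label.over p.crossing) (Label.under p.crossing)).foldr
    Gamma.disjointUnion Gamma.empty

theorem crossingUnion_scalar (w : List Letter) : (crossingUnion w).scalar = 1 := by
  induction w with
  | nil => rfl
  | cons p w ih =>
    have : (crossingUnion (p :: w)).scalar = 1 * (crossingUnion w).scalar := rfl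
    rw [this, ih, one_mul]

theorem crossingUnion_mat_cons (p : Letter) (w : List Letter) :
    (crossingUnion (p :: w)).mat =
      (Gamma.crossing p.sign (Label.over p.crossing) (Label.under p.crossing)).mat +
        (crossingUnion w).mat := rfl

theorem isDiagonalAtOne_crossingUnion (w : List Letter) :
    (crossingUnion w).IsDiagonalAtOne := by
  induction w with
  | nil => intro i j _; simp [crossingUnion, Gamma.empty]
  | cons p w ih =>
    intro i j hij
    rw [crossingUnion_mat_cons, Matrix.add_apply, map_add, ih i j hij, add_zero]
    have h : ∀ (a : Label) (r : RegularFunction), Matrix.single a a r i j = 0 := by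
      intro a r
      rw [Matrix.single_apply, if_neg]
      rintro ⟨rfl, h⟩
      exact hij h
    simp only [Gamma.crossing, Matrix.add_apply, h, Matrix.single_apply, zero_add, add_zero]
    split_ifs <;> simp [evalOne_tPow]

/-- The crossing to which the strand belongs is listed in `w`. -/
def Label.OccursIn (w : List Letter) : Label → Prop
  | Label.over c => c ∈ w.map Letter.crossing
  | Label.under c => c ∈ w.map Letter.crossing
  | Label.comp _ => False

open scoped Classical in
-- `crossingMat` contains a crossing for every natural number. The union of the crossings present is
-- its restriction to their labels, and the determinant never sees anything else.
theorem specMat_crossingUnion {w : List Letter} (hw : (w.map Letter.crossing).Nodup)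
    {τ : ℕ → RatFunc ℚ} (hτ : ∀ p ∈ w, τ p.crossing = (sqrtT ^ 2) ^ (p.sign : ℤ)) (i j : Label) :
    (crossingUnion w).specMat i j =
      if i.OccursIn w ∧ j.OccursIn w then crossingMat τ i j else 0 := by
  induction w with
  | nil => cases i <;> simp [crossingUnion, Gamma.empty, Gamma.specMat, Label.OccursIn]
  | cons p w ih =>
    rw [List.map_cons, List.nodup_cons] at hw
    have ih := ih hw.2 fun q hq => hτ q (List.mem_cons_of_mem _ hq)
    have hp := hτ p List.mem_cons_self
    have hpw := hw.1
    rw [Gamma.specMat, Matrix.map_apply] at ih ⊢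
    rw [crossingUnion_mat_cons, Matrix.add_apply, map_add, ih]
    simp only [Gamma.crossing, Matrix.add_apply, Matrix.single_apply, map_add,
      apply_ite specialize, map_one, map_sub, map_zero, specialize_tPow, ← hp]
    rcases i with c | c | c <;> rcases j with d | d | d <;>
      simp only [Label.OccursIn, crossingMat, List.map_cons, List.mem_cons, Label.over.injEq,
        Label.under.injEq, reduceCtorEq, and_false, false_and, if_false, add_zero, zero_add,
        ite_self]
    all_goals
      by_cases hc : p.crossing = c
      · subst hc
        by_cases hd : p.crossing = d
        · subst hd
          simp [hpw]
        · simp [hpw, hd]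
      · by_cases hd : p.crossing = d
        · subst hd
          simp [hpw, hc, Ne.symm hc]
        · simp [hc, hd, Ne.symm hc, Ne.symm hd]

namespace Diagram

variable {D : Diagram}

/-- The cyclic words of labels of the components of a diagram. -/
def words (D : Diagram) : List (List Label) := baseWords 0 (D.strand :: D.circles)

/-- `τ c` is `t` to the sign of the crossing `c`. -/
def HasPowers (D : Diagram) (τ : ℕ → RatFunc ℚ) : Prop :=
  ∀ p ∈ D.letters, τ p.crossing = (sqrtT ^ 2) ^ (p.sign : ℤ)

theorem nodup_words (D : Diagram) : D.words.flatten.Nodup := by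
  rw [words, nodup_baseWords_iff, nodup_map_label_iff]
  exact D.nodup

theorem eq_of_crossing_eq {p q : Letter} (hp : p ∈ D.letters) (hq : q ∈ D.letters)
    (hc : p.crossing = q.crossing) (ho : p.isOver = q.isOver) : p = q :=
  List.inj_on_of_nodup_map D.nodup hp hq (by rw [hc, ho])

theorem sign_eq_of_crossing_eq {p q : Letter} (hp : p ∈ D.letters) (hq : q ∈ D.letters)
    (hc : p.crossing = q.crossing) : p.sign = q.sign := by
  by_cases ho : p.isOver = q.isOver
  · rw [eq_of_crossing_eq hp hq hc ho]
  · have : p = q.flip := by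
      refine eq_of_crossing_eq hp (D.flip_mem q hq) hc ?_
      rw [Letter.flip]
      revert ho
      cases p.isOver <;> cases q.isOver <;> simp
    rw [this]
    rfl

open scoped Classical in
theorem exists_hasPowers (D : Diagram) : ∃ τ, D.HasPowers τ := by
  refine ⟨fun c => if h : ∃ p ∈ D.letters, p.crossing = c
    then (sqrtT ^ 2) ^ (h.choose.sign : ℤ) else 1, ?_⟩
  intro p hp
  have h : ∃ q ∈ D.letters, q.crossing = p.crossing := ⟨p, hp, rfl⟩
  simp only [dif_pos h]
  rw [sign_eq_of_crossing_eq h.choose_spec.1 hp h.choose_spec.2]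

theorem mem_flatten_words {x : Label} : x ∈ D.words.flatten ↔
    (∃ m < D.circles.length + 1, x = Label.comp m) ∨ ∃ p ∈ D.letters, p.label = x := by
  rw [words, (flatten_baseWords_perm _ _).mem_iff]
  have h : (D.strand :: D.circles).flatten = D.letters := rfl
  rw [List.mem_append, h, List.mem_map]
  simp [eq_comm]

theorem nodup_crossing_overLetters (D : Diagram) : (D.overLetters.map Letter.crossing).Nodup := by
  refine (List.nodup_map_iff_inj_on ?_).2 ?_
  · exact (List.Nodup.of_map _ D.nodup).filter _
  · intro p hp q hq h
    rw [overLetters, List.mem_filter] at hp hq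
    exact eq_of_crossing_eq hp.1 hq.1 h (by rw [hp.2, hq.2])

theorem occursIn_overLetters {p : Letter} (hp : p ∈ D.letters) :
    p.label.OccursIn D.overLetters := by
  have : p.crossing ∈ D.overLetters.map Letter.crossing := by
    rw [List.mem_map]
    by_cases ho : p.isOver
    · exact ⟨p, List.mem_filter.2 ⟨hp, ho⟩, rfl⟩
    · exact ⟨p.flip, List.mem_filter.2 ⟨D.flip_mem p hp, by simpa [Letter.flip] using ho⟩, rfl⟩
  unfold Letter.label
  split_ifs
  · exact this
  · exact this

/-- Undoing all stitchings at once leaves the disjoint union of the crossings, with scalar `1`,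
glued along the words of the diagram. -/
theorem omega_eq_wordDet {τ : ℕ → RatFunc ℚ} (hτ : D.HasPowers τ) :
    D.omega = wordDet (crossingMat τ) D.words := by
  have hcr : D.crossings = crossingUnion D.overLetters := rfl
  have h := Gamma.value_stitchWords (D.strand :: D.circles) (n := 0) (cs := [])
    (isDiagonalAtOne_crossingUnion D.overLetters) (by rw [List.append_nil]; exact D.nodup_words)
  rw [List.append_nil, List.append_nil, List.length_cons, zero_add, Gamma.value_components] at h
  rw [omega, phi, hcr, h, Gamma.value, crossingUnion_scalar, map_one, one_mul]
  apply wordDet_congr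
  have hτ' : ∀ p ∈ D.overLetters, τ p.crossing = (sqrtT ^ 2) ^ (p.sign : ℤ) :=
    fun p hp => hτ p (List.mem_filter.1 hp).1
  intro i hi j hj
  have hi := mem_flatten_words.1 hi
  have hj := mem_flatten_words.1 hj
  -- On labels of base points all entries come from `freeEntry 0`; on labels of passages they come
  -- from the crossings.
  rw [Gamma.augment, specMat_crossingUnion D.nodup_crossing_overLetters hτ']
  rcases hi with ⟨m, -, rfl⟩ | ⟨p, hp, rfl⟩
  · rcases hj with ⟨n, -, rfl⟩ | ⟨q, hq, rfl⟩
    · by_cases hm : m = 0 <;> by_cases hmn : m = n <;>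
        simp [Label.OccursIn, crossingMat, freeEntry, hm, hmn]
    · have := q.label_ne_comp m
      have h0 : crossingMat τ (Label.comp m) q.label = 0 := by
        unfold Letter.label
        split_ifs <;> rfl
      simp [Label.OccursIn, h0, this.symm]
  · rw [if_neg (p.label_ne_comp 0), freeEntry_of_ne_comp p.label_ne_comp]
    rcases hj with ⟨n, -, rfl⟩ | ⟨q, hq, rfl⟩
    · have h0 : crossingMat τ p.label (Label.comp n) = 0 := by
        unfold Letter.label
        split_ifs <;> rfl
      simp [h0]
    · simp [occursIn_overLetters hp, occursIn_overLetters hq]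

end Diagram

/-! ### Local modifications of the matrix -/

section Local

variable {α : Type*} {K : Type*} [Field K]

/-- The matrix `M` is block diagonal with respect to `T` and its complement. -/
def IsBlockOn (T : Set α) (M : Matrix α α K) : Prop :=
  ∀ i j, ¬ (i ∈ T ↔ j ∈ T) → M i j = 0

theorem IsBlockOn.submatrix {T : Set α} {M : Matrix α α K} (hM : IsBlockOn T M) {e : Perm α}
    (he : ∀ i, e i ∈ T ↔ i ∈ T) : IsBlockOn T (M.submatrix e e) := by
  intro i j h
  exact hM _ _ (by rwa [he, he])

variable [DecidableEq α]

theorem IsBlockOn.stitchMat {T : Set α} {M : Matrix α α K} (hM : IsBlockOn T M) {a b : α}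
    (ha : a ∈ T) (hb : b ∈ T) : IsBlockOn T (stitchMat a b M) := by
  intro i j h
  unfold WLink.stitchMat
  have hj : (if j = a then b else j) ∈ T ↔ j ∈ T := by
    split_ifs with h
    · simp [h, ha, hb]
    · rfl
  by_cases h1 : i = b ∨ j = b
  · exact if_pos h1
  · rw [if_neg h1]
    by_cases hi : i ∈ T
    · have : j ∉ T := fun hj => h ⟨fun _ => hj, fun _ => hi⟩
      rw [hM _ _ (by rw [hj]; exact h), hM b _ (by rw [hj]; tauto)]
      simp
    · rw [hM _ _ (by rw [hj]; exact h), hM i a (by tauto)]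
      simp

theorem IsBlockOn.stitchMat_apply {T : Set α} {M : Matrix α α K} (hM : IsBlockOn T M) {a b i j : α}
    (ha : a ∈ T) (hb : b ∈ T) (hi : i ∉ T) (hj : j ∉ T) : WLink.stitchMat a b M i j = M i j := by
  have h : ∀ {x y}, x ∉ T → y ∈ T → x ≠ y := by
    rintro x y hx hy rfl
    exact hx hy
  simp [WLink.stitchMat, h hi hb, h hj hb, h hj ha, hM i a (by tauto)]

/-- Two matrices that agree outside `T` and after three stitchings inside `T` give the same
determinant. -/
theorem wordDet_eq_of_stitch₃ {M N : Matrix α α K} {cs : List (List α)} (hn : cs.flatten.Nodup)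
    {T : Set α} {a₁ b₁ a₂ b₂ a₃ b₃ : α} (hT : T = {a₁, b₁, a₂, b₂, a₃, b₃})
    (hd : [a₁, b₁, a₂, b₂, a₃, b₃].Nodup)
    (h₁ : wordPerm cs a₁ = b₁) (h₂ : wordPerm cs a₂ = b₂) (h₃ : wordPerm cs a₃ = b₃)
    (hM : IsBlockOn T M) (hN : IsBlockOn T N) (hout : ∀ i ∉ T, ∀ j ∉ T, M i j = N i j)
    (hM₁ : M b₁ a₁ = 0) (hM₂ : stitchMat a₁ b₁ M b₂ a₂ = 0)
    (hM₃ : stitchMat a₂ b₂ (stitchMat a₁ b₁ M) b₃ a₃ = 0)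
    (hN₁ : N b₁ a₁ = 0) (hN₂ : stitchMat a₁ b₁ N b₂ a₂ = 0)
    (hN₃ : stitchMat a₂ b₂ (stitchMat a₁ b₁ N) b₃ a₃ = 0)
    (hin : ∀ i ∈ [a₁, a₂, a₃], ∀ j ∈ [a₁, a₂, a₃],
      stitchMat a₃ b₃ (stitchMat a₂ b₂ (stitchMat a₁ b₁ M)) i j =
        stitchMat a₃ b₃ (stitchMat a₂ b₂ (stitchMat a₁ b₁ N)) i j) :
    wordDet M cs = wordDet N cs := by
  simp only [List.nodup_cons, List.mem_cons, not_or, List.not_mem_nil, not_false_eq_true,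
    and_true, List.nodup_nil] at hd
  obtain ⟨⟨d1, d2, d3, d4, d5⟩, ⟨d6, d7, d8, d9⟩, ⟨d10, d11, d12⟩, ⟨d13, d14⟩, d15⟩ := hd
  -- Erasing a letter does not affect the adjacency of two others, so the three stitchings can be
  -- performed in succession.
  have hs : ∀ {cs : List (List α)}, cs.flatten.Nodup → ∀ {b x y : α}, wordPerm cs x = y → x ≠ b →
      y ≠ b → wordPerm (eraseLetter b cs) x = y := by
    intro cs hn b x y hx hxb hyb
    rw [wordPerm_eraseLetter hn, Perm.mul_apply, hx, swap_apply_of_ne_of_ne hyb]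
    intro h
    exact hxb ((wordPerm cs).injective (hx.trans h))
  have hn1 := nodup_eraseLetter (x := b₁) hn
  have hn2 := nodup_eraseLetter (x := b₂) hn1
  have h₂' := hs hn h₂ (Ne.symm d6) (Ne.symm d7)
  have h₃' := hs hn1 (hs hn h₃ (Ne.symm d8) (Ne.symm d9)) (Ne.symm d13) (Ne.symm d14)
  rw [wordDet_stitch hn d1 h₁ (by simp [hM₁]), wordDet_stitch hn1 d10 h₂' (by simp [hM₂]),
    wordDet_stitch hn2 d15 h₃' (by simp [hM₃]), hM₁, hM₂, hM₃,
    wordDet_stitch hn d1 h₁ (by simp [hN₁]), wordDet_stitch hn1 d10 h₂' (by simp [hN₂]),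
    wordDet_stitch hn2 d15 h₃' (by simp [hN₃]), hN₁, hN₂, hN₃]
  simp only [sub_zero, one_mul]
  have ha₁ : a₁ ∈ T := by simp [hT]
  have hb₁ : b₁ ∈ T := by simp [hT]
  have ha₂ : a₂ ∈ T := by simp [hT]
  have hb₂ : b₂ ∈ T := by simp [hT]
  have ha₃ : a₃ ∈ T := by simp [hT]
  have hb₃ : b₃ ∈ T := by simp [hT]
  have hM1 := hM.stitchMat ha₁ hb₁
  have hM2 := hM1.stitchMat ha₂ hb₂
  have hM3 := hM2.stitchMat ha₃ hb₃
  have hN1 := hN.stitchMat ha₁ hb₁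
  have hN2 := hN1.stitchMat ha₂ hb₂
  have hN3 := hN2.stitchMat ha₃ hb₃
  apply wordDet_congr
  intro i hi j hj
  simp only [flatten_eraseLetter, List.mem_filter, decide_eq_true_eq] at hi hj
  -- Of `T` only `a₁`, `a₂`, `a₃` are left. Mixed entries vanish by the block structure, and entries
  -- outside `T` were never changed.
  by_cases hiT : i ∈ T
  · by_cases hjT : j ∈ T
    · apply hin
      · rw [hT] at hiT
        simp only [Set.mem_insert_iff, Set.mem_singleton_iff, List.mem_cons, List.not_mem_nil,
          or_false] at hiT ⊢
        tauto
      · rw [hT] at hjT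
        simp only [Set.mem_insert_iff, Set.mem_singleton_iff, List.mem_cons, List.not_mem_nil,
          or_false] at hjT ⊢
        tauto
    · rw [hM3 i j (by tauto), hN3 i j (by tauto)]
  · by_cases hjT : j ∈ T
    · rw [hM3 i j (by tauto), hN3 i j (by tauto)]
    · rw [hM2.stitchMat_apply ha₃ hb₃ hiT hjT, hM1.stitchMat_apply ha₂ hb₂ hiT hjT,
        hM.stitchMat_apply ha₁ hb₁ hiT hjT, hN2.stitchMat_apply ha₃ hb₃ hiT hjT,
        hN1.stitchMat_apply ha₂ hb₂ hiT hjT, hN.stitchMat_apply ha₁ hb₁ hiT hjT, hout i hiT j hjT]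

theorem isBlockOn_crossingMat {τ : ℕ → K} {T : Set Label}
    (hT : ∀ c, Label.over c ∈ T ↔ Label.under c ∈ T) :
    IsBlockOn T (crossingMat τ) := by
  intro i j h
  rcases i with c | c | c <;> rcases j with d | d | d <;> simp only [crossingMat] <;>
    try (rw [if_neg]; rintro rfl; revert h; simp [hT])
  rw [if_neg]
  rintro ⟨rfl, _⟩
  simp at h

end Local

/-! ### The third Reidemeister move -/

section Reidemeister3

variable {K : Type*} [Field K] {τ : ℕ → K} {x y z : ℕ} {cs : List (List Label)}

/-- The two consecutive letters are `a`, `b` or `b`, `a`, according to a sign. -/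
def IsArc (cs : List (List Label)) (ε : ℤˣ) (a b : Label) : Prop :=
  if ε = 1 then wordPerm cs a = b else wordPerm cs b = a

set_option maxHeartbeats 1000000 in
-- Strands `x`, `y`, `z` are the crossings top-middle, top-bottom and middle-bottom. The permutation
-- `e` exchanges the two passages on each side of the triangle, so the other side of the move is the
-- same gluing with a relabelled matrix. Eliminating the three sides leaves a 3 × 3 block for each
-- matrix, and the relation between directions and signs makes the two blocks equal.
theorem wordDet_reidemeister3 (hn : cs.flatten.Nodup) (hxy : x ≠ y) (hxz : x ≠ z) (hyz : y ≠ z)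
    {ε₁ ε₂ ε₃ : ℤˣ} (top : IsArc cs ε₁ (Label.over x) (Label.over y))
    (middle : IsArc cs ε₂ (Label.under x) (Label.over z))
    (bottom : IsArc cs ε₃ (Label.under y) (Label.under z)) {u : K} (hu : u ≠ 0)
    (hx : τ x = u ^ ((ε₁ * ε₂ * ε₃ : ℤˣ) : ℤ)) (hy : τ y = u ^ (ε₁ : ℤ))
    (hz : τ z = u ^ (ε₂ : ℤ)) {e : Perm Label}
    (he : e = swap (Label.over x) (Label.over y) * swap (Label.under x) (Label.over z) *
      swap (Label.under y) (Label.under z)) :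
    wordDet (crossingMat τ) cs = wordDet ((crossingMat τ).submatrix e e) cs := by
  have e1 : e (Label.over x) = Label.over y := by
    simp [he, swap_apply_def, hxz]
  have e2 : e (Label.over y) = Label.over x := by
    simp [he, swap_apply_def, hyz]
  have e3 : e (Label.under x) = Label.over z := by
    simp [he, swap_apply_def, hxy, hxz, hxz.symm, hyz.symm]
  have e4 : e (Label.over z) = Label.under x := by
    simp [he, swap_apply_def]
  have e5 : e (Label.under y) = Label.under z := by
    simp [he, swap_apply_def, hxz.symm]
  have e6 : e (Label.under z) = Label.under y := by
    simp [he, swap_apply_def, hxy.symm]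
  set T : Set Label := {Label.over x, Label.over y, Label.under x, Label.over z, Label.under y,
    Label.under z} with hT
  have hfix : ∀ i ∉ T, e i = i := by
    intro i hi
    simp only [hT, Set.mem_insert_iff, Set.mem_singleton_iff, not_or] at hi
    simp [he, swap_apply_def, hi]
  have heT : ∀ i, e i ∈ T ↔ i ∈ T := by
    intro i
    by_cases hi : i ∈ T
    · refine ⟨fun _ => hi, fun _ => ?_⟩
      simp only [hT, Set.mem_insert_iff, Set.mem_singleton_iff] at hi
      rcases hi with rfl | rfl | rfl | rfl | rfl | rfl <;> simp [e1, e2, e3, e4, e5, e6, hT]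
    · rw [hfix i hi]
  have hM : IsBlockOn T (crossingMat τ) := by
    apply isBlockOn_crossingMat
    intro c
    simp only [hT, Set.mem_insert_iff, Set.mem_singleton_iff, Label.over.injEq,
      Label.under.injEq, reduceCtorEq, false_or, or_false]
  have hN := hM.submatrix heT
  have hout : ∀ i ∉ T, ∀ j ∉ T, crossingMat τ i j = (crossingMat τ).submatrix e e i j := by
    intro i hi j hj
    rw [Matrix.submatrix_apply, hfix i hi, hfix j hj]
  -- There are eight choices of directions for the sides; in each the three pivots are `1` for both
  -- matrices.
  rcases Int.units_eq_one_or ε₁ with rfl | rfl <;> rcases Int.units_eq_one_or ε₂ with rfl | rfl <;>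
    rcases Int.units_eq_one_or ε₃ with rfl | rfl <;>
    simp only [IsArc, if_true, if_neg (show (-1 : ℤˣ) ≠ 1 by decide)] at top middle bottom <;>
    simp at hx hy hz <;>
    refine wordDet_eq_of_stitch₃ hn (T := T) ?_ ?_ top middle bottom hM hN hout ?_ ?_ ?_ ?_ ?_ ?_ ?_
  all_goals
    try simp only [List.mem_cons, List.not_mem_nil, or_false, forall_eq_or_imp, forall_eq]
    try simp [stitchMat, e1, e2, e3, e4, e5, e6, crossingMat, hxy, hxz, hyz, hxy.symm, hxz.symm,
      hyz.symm, hx, hy, hz]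
  all_goals first
    | exact hT
    | (rw [hT]; ext i; simp only [Set.mem_insert_iff, Set.mem_singleton_iff]; tauto)
    -- What remains are the entries of the 3 × 3 blocks: rational identities in `u`.
    | (constructorm* _ ∧ _ <;> (try field_simp) <;> ring)

end Reidemeister3

/-! ### Commutation of overcrossings -/

section Overcrossings

variable {α : Type*} [DecidableEq α] {K : Type*} [Field K]

/-- Two consecutive strands commute if their columns are those of the identity. -/
theorem wordDet_swap {M : Matrix α α K} {cs : List (List α)} (hn : cs.flatten.Nodup) {a b : α}
    (hab : a ≠ b) (h : wordPerm cs a = b) (ha : ∀ i, M i a = if i = a then 1 else 0)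
    (hb : ∀ i, M i b = if i = b then 1 else 0) :
    wordDet M cs = wordDet (M.submatrix (swap a b) (swap a b)) cs := by
  have h1 : M b a = 0 := by simp [ha, hab.symm]
  have h2 : M a b = 0 := by simp [hb, hab]
  -- Both orders have pivot `1`, and after stitching they give the same matrix: the two rows are
  -- added and so are the two columns.
  rw [wordDet_stitch hn hab h (by simp [h1]), wordDet_stitch hn hab h (by simp [h2])]
  simp only [Matrix.submatrix_apply, swap_apply_left, swap_apply_right, h1, h2]
  congr 2
  ext i j : 2
  simp only [stitchMat, Matrix.submatrix_apply, swap_apply_left, swap_apply_right]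
  split_ifs with h3 h4
  · rfl
  · by_cases hi : i = a
    · simp [hi, ha, hb, hab, hab.symm]
    · rw [not_or] at h3
      simp [ha, hb, swap_apply_of_ne_of_ne hi h3.1, hi, h3.1]
  · rw [not_or] at h3
    rw [swap_apply_of_ne_of_ne h4 h3.2]
    by_cases hi : i = a
    · simp [hi, ha, hb, hab, hab.symm, add_comm]
    · simp [ha, hb, swap_apply_of_ne_of_ne hi h3.1, hi, h3.1]

/-- An over-strand has the column of the identity, which is the condition needed in `wordDet_swap`.
The column of an under-strand has the additional entry `1 - τ c`. -/
theorem crossingMat_over (τ : ℕ → K) (i : Label) (c : ℕ) :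
    crossingMat τ i (Label.over c) = if i = Label.over c then 1 else 0 := by
  cases i <;> simp [crossingMat]

end Overcrossings

/-! ### The second Reidemeister move -/

section Reidemeister2

variable {K : Type*} [Field K] {τ : ℕ → K} {x y : ℕ} {cs : List (List Label)}

/-- Every word contains a base point. -/
def HasBase (cs : List (List Label)) : Prop := ∀ w ∈ cs, ∃ m, Label.comp m ∈ w

theorem HasBase.eraseLetter {cs : List (List Label)} (h : HasBase cs) {a : Label}
    (ha : ∀ k, a ≠ Label.comp k) : HasBase (eraseLetter a cs) := by
  intro w hw
  obtain ⟨v, hv, rfl⟩ := List.mem_map.1 hw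
  obtain ⟨m, hm⟩ := h v hv
  exact ⟨m, List.mem_filter.2 ⟨hm, by simpa using (ha m).symm⟩⟩

theorem HasBase.singleton_notMem {cs : List (List Label)} (h : HasBase cs) {a : Label}
    (ha : ∀ k, a ≠ Label.comp k) : [a] ∉ cs := by
  intro hcs
  obtain ⟨m, hm⟩ := h _ hcs
  exact ha m (List.mem_singleton.1 hm).symm

/-- After stitching the two over-strands and the two under-strands, the factors `τ x` and `τ y`
cancel and two trivial strands are left. These can be erased because every word also contains a base
point. The two options for `a`, `b` are the two directions of the lower strand. -/
theorem wordDet_reidemeister2 (hn : cs.flatten.Nodup) (hcs : HasBase cs) (hxy : x ≠ y)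
    {a b : Label} (hab : (a = Label.under x ∧ b = Label.under y) ∨
      (a = Label.under y ∧ b = Label.under x))
    (hover : wordPerm cs (Label.over x) = Label.over y) (hunder : wordPerm cs a = b)
    (hτ : τ x * τ y = 1) :
    wordDet (crossingMat τ) cs = wordDet (crossingMat τ)
      (eraseLetter a (eraseLetter (Label.over x)
        (eraseLetter b (eraseLetter (Label.over y) cs)))) := by
  set T : Set Label := {Label.over x, Label.over y, Label.under x, Label.under y} with hT
  have hM : IsBlockOn T (crossingMat τ) := by
    apply isBlockOn_crossingMat
    intro c
    simp only [hT, Set.mem_insert_iff, Set.mem_singleton_iff, Label.over.injEq,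
      Label.under.injEq, reduceCtorEq, false_or, or_false]
  have hox : Label.over x ∈ T := by simp [hT]
  have hoy : Label.over y ∈ T := by simp [hT]
  have ha : a ∈ T := by rcases hab with h | h <;> simp [hT, h.1]
  have hb : b ∈ T := by rcases hab with h | h <;> simp [hT, h.2]
  have hM1 := hM.stitchMat hox hoy
  have hM2 := hM1.stitchMat ha hb
  have hab' : a ≠ b := by rcases hab with ⟨rfl, rfl⟩ | ⟨rfl, rfl⟩ <;> simp [hxy, hxy.symm]
  have hac : ∀ k, a ≠ Label.comp k := by rcases hab with ⟨rfl, rfl⟩ | ⟨rfl, rfl⟩ <;> simp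
  have hbc : ∀ k, b ≠ Label.comp k := by rcases hab with ⟨rfl, rfl⟩ | ⟨rfl, rfl⟩ <;> simp
  have h0 : crossingMat τ (Label.over y) (Label.over x) = 0 := by simp [crossingMat, hxy.symm]
  have h0' : stitchMat (Label.over x) (Label.over y) (crossingMat τ) b a = 0 := by
    rcases hab with ⟨rfl, rfl⟩ | ⟨rfl, rfl⟩ <;>
      simp [stitchMat, crossingMat, hxy, hxy.symm]
  have hn1 := nodup_eraseLetter (x := Label.over y) hn
  have hn2 := nodup_eraseLetter (x := b) hn1
  have hn3 := nodup_eraseLetter (x := Label.over x) hn2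
  have hunder' : wordPerm (eraseLetter (Label.over y) cs) a = b := by
    rw [wordPerm_eraseLetter hn, Perm.mul_apply, hunder, swap_apply_of_ne_of_ne]
    · rcases hab with ⟨rfl, rfl⟩ | ⟨rfl, rfl⟩ <;> simp
    · rw [← hunder]
      intro h
      have := (wordPerm cs).injective h
      rcases hab with ⟨rfl, rfl⟩ | ⟨rfl, rfl⟩ <;> simp at this
  have hinv : τ y * τ x = 1 := by rw [mul_comm, hτ]
  have htriv : ∀ z, z = Label.over x ∨ z = a → IsTrivialAt
      (stitchMat a b (stitchMat (Label.over x) (Label.over y) (crossingMat τ))) z := by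
    intro z hz j
    have hzT : z ∈ T := by rcases hz with rfl | rfl <;> assumption
    by_cases hj : j ∈ T
    · simp only [hT, Set.mem_insert_iff, Set.mem_singleton_iff] at hj
      rcases hab with ⟨rfl, rfl⟩ | ⟨rfl, rfl⟩ <;> rcases hz with rfl | rfl <;>
        rcases hj with rfl | rfl | rfl | rfl <;>
        simp [stitchMat, crossingMat, hxy, hxy.symm, hτ, hinv] <;>
        -- The remaining entry has the form `(1 - τ y) + (1 - τ x) * τ y`, or the same with `x` and
        -- `y` exchanged, and so equals `1 - τ x * τ y = 0`.
        linear_combination -hτ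
    · have : z ≠ j := by
        rintro rfl
        exact hj hzT
      rw [hM2 z j (by tauto), hM2 j z (by tauto), if_neg this]
      simp
  rw [wordDet_stitch hn (by simpa using hxy) hover (by simp [h0]),
    wordDet_stitch hn1 hab' hunder' (by simp [h0']), h0, h0', sub_zero, one_mul, one_mul,
    wordDet_eraseLetter hn2 (htriv _ (Or.inl rfl))
      (((hcs.eraseLetter (by simp)).eraseLetter hbc).singleton_notMem (by simp)),
    wordDet_eraseLetter hn3 (htriv _ (Or.inr rfl))
      ((((hcs.eraseLetter (by simp)).eraseLetter hbc).eraseLetter (by simp)).singleton_notMem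
        hac)]
  apply wordDet_congr
  intro i hi j hj
  simp only [flatten_eraseLetter, List.mem_filter, decide_eq_true_eq] at hi hj
  have hnot : ∀ k, ((((k ∈ cs.flatten ∧ k ≠ Label.over y) ∧ k ≠ b) ∧ k ≠ Label.over x) ∧ k ≠ a) →
      k ∉ T := by
    intro k hk
    simp only [hT, Set.mem_insert_iff, Set.mem_singleton_iff]
    rcases hab with ⟨rfl, rfl⟩ | ⟨rfl, rfl⟩ <;> tauto
  rw [hM1.stitchMat_apply ha hb (hnot i hi) (hnot j hj),
    hM.stitchMat_apply hox hoy (hnot i hi) (hnot j hj)]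

end Reidemeister2

/-! ### The skein relation for determinants -/

section Skein

variable {K : Type*} [Field K]

/-- The determinant as a bilinear form in two of the rows. -/
def detRows {n : Type*} [Fintype n] [DecidableEq n] (A : Matrix n n K) {p q : n} (hpq : p ≠ q) :
    (n → K) →ₗ[K] (n → K) →ₗ[K] K :=
  LinearMap.mk₂ K (fun v w => ((A.updateRow p v).updateRow q w).det)
    (fun v v' w => by
      simp only [Matrix.updateRow_comm _ hpq, Matrix.det_updateRow_add])
    (fun c v w => by
      simp only [Matrix.updateRow_comm _ hpq, Matrix.det_updateRow_smul, smul_eq_mul])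
    (fun v w w' => by rw [Matrix.det_updateRow_add])
    (fun c v w => by rw [Matrix.det_updateRow_smul, smul_eq_mul])

theorem detRows_apply {n : Type*} [Fintype n] [DecidableEq n] (A : Matrix n n K) {p q : n}
    (hpq : p ≠ q) (v w : n → K) :
    detRows A hpq v w = ((A.updateRow p v).updateRow q w).det := rfl

theorem detRows_self {n : Type*} [Fintype n] [DecidableEq n] (A : Matrix n n K) {p q : n}
    (hpq : p ≠ q) (v : n → K) : detRows A hpq v v = 0 := by
  rw [detRows_apply]
  exact Matrix.det_zero_of_row_eq hpq (by simp [Matrix.updateRow_ne hpq])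

theorem detRows_swap {n : Type*} [Fintype n] [DecidableEq n] (A : Matrix n n K) {p q : n}
    (hpq : p ≠ q) (v w : n → K) : detRows A hpq v w = -detRows A hpq w v := by
  have h := detRows_self A hpq (v + w)
  simp only [map_add, LinearMap.add_apply, detRows_self] at h
  linear_combination h

theorem crossingMat_update {τ : ℕ → K} {c : ℕ} {i : Label} (ho : i ≠ Label.over c)
    (hu : i ≠ Label.under c) (r : K) (j : Label) :
    crossingMat (Function.update τ c r) i j = crossingMat τ i j := by
  rcases i with d | d | d
  · have hd : d ≠ c := fun h => ho (by rw [h])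
    cases j <;> simp only [crossingMat, Function.update_of_ne hd]
  · have hd : d ≠ c := fun h => hu (by rw [h])
    cases j <;> simp only [crossingMat, Function.update_of_ne hd]
  · cases j <;> rfl

theorem crossingMat_eq_zero {τ : ℕ → K} {c : ℕ} {i : Label} (ho : i ≠ Label.over c)
    (hu : i ≠ Label.under c) :
    crossingMat τ i (Label.over c) = 0 ∧ crossingMat τ i (Label.under c) = 0 := by
  rcases i with d | d | d
  · have hd : d ≠ c := fun h => ho (by rw [h])
    simp [crossingMat, hd]
  · have hd : d ≠ c := fun h => hu (by rw [h])
    simp [crossingMat, hd]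
  · exact ⟨rfl, rfl⟩

/-- The negative crossing is the positive one with over and under exchanged and `t` inverted; the
smoothing is a crossing with `t = 1` after exchanging the successors of its two strands. All three
determinants agree outside the rows of `c`, so the relation holds by expanding one alternating form
in these rows. -/
theorem permDet_skein {τ : ℕ → K} {c : ℕ} {σ : Perm Label} {s : Finset Label}
    (ho : Label.over c ∈ s) (hu : Label.under c ∈ s) {t : K} (ht : t ≠ 0) :
    permDet (crossingMat (Function.update τ c t)) σ s -
      t * permDet ((crossingMat (Function.update τ c t⁻¹)).submatrix
        (swap (Label.over c) (Label.under c)) (swap (Label.over c) (Label.under c))) σ s =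
      (1 - t) * permDet (crossingMat (Function.update τ c 1))
        (σ * swap (Label.over c) (Label.under c)) s := by
  let o : s := ⟨Label.over c, ho⟩
  let u : s := ⟨Label.under c, hu⟩
  have hou : o ≠ u := by simp [o, u]
  -- `B` supplies the common rows; its rows at `o` and `u` are overwritten in `detRows`.
  let B : Matrix s s K := (gluingMat (crossingMat (Function.update τ c 1))
    (σ * swap (Label.over c) (Label.under c))).submatrix Subtype.val Subtype.val
  -- `eo`, `eu` are the rows of the identity and `fo`, `fu` the rows of the gluing permutation; the
  -- two special rows of all three matrices are combinations of these four.
  let eo : s → K := fun j => if Label.over c = (j : Label) then 1 else 0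
  let eu : s → K := fun j => if Label.under c = (j : Label) then 1 else 0
  let fo : s → K := fun j => if Label.over c = σ.symm j then 1 else 0
  let fu : s → K := fun j => if Label.under c = σ.symm j then 1 else 0
  have hrow : ∀ (A : Matrix Label Label K) (ρ : Perm Label) (v w : s → K),
      (∀ i, i ≠ Label.over c → i ≠ Label.under c → ∀ j,
        A i (ρ.symm j) = crossingMat (Function.update τ c 1) i
          ((σ * swap (Label.over c) (Label.under c)).symm j)) →
      (∀ j : s, gluingMat A ρ (Label.over c) j = v j) →
      (∀ j : s, gluingMat A ρ (Label.under c) j = w j) →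
      permDet A ρ s = detRows B hou v w := by
    intro A ρ v w h hv hw
    rw [detRows_apply, permDet, detOn]
    congr 1
    ext i j
    rw [Matrix.submatrix_apply]
    by_cases hiu : i = u
    · rw [hiu, Matrix.updateRow_self]
      exact hw j
    · rw [Matrix.updateRow_ne hiu]
      by_cases hio : i = o
      · rw [hio, Matrix.updateRow_self]
        exact hv j
      · rw [Matrix.updateRow_ne hio]
        change (if (i : Label) = j then (1 : K) else 0) - A i (ρ.symm j) = _ - _
        rw [h]
        · exact fun h => hio (Subtype.ext h)
        · exact fun h => hiu (Subtype.ext h)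

  have hsymm : ∀ j, (σ * swap (Label.over c) (Label.under c)).symm j =
      swap (Label.over c) (Label.under c) (σ.symm j) := by
    intro j
    rw [Equiv.symm_apply_eq]
    simp
  -- Rows of other strands vanish in both columns of the crossing `c`, so they notice neither the
  -- value at `c` nor the exchange.
  have hagree : ∀ r i, i ≠ Label.over c → i ≠ Label.under c → ∀ l,
      crossingMat (Function.update τ c r) i l = crossingMat (Function.update τ c 1) i
        (swap (Label.over c) (Label.under c) l) := by
    intro r i hio hiu l
    rw [crossingMat_update hio hiu, crossingMat_update hio hiu, swap_apply_def]
    have h0 := crossingMat_eq_zero (τ := τ) hio hiu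
    split_ifs with h1 h2
    · rw [h1, h0.1, h0.2]
    · rw [h2, h0.1, h0.2]
    · rfl
  have hpos : permDet (crossingMat (Function.update τ c t)) σ s =
      detRows B hou (eo - fo - (1 - t) • fu) (eu - t • fu) := by
    apply hrow
    · intro i hio hiu j
      rw [hsymm, hagree t i hio hiu]
    · intro j
      simp only [gluingMat, eo, fo, fu, Pi.sub_apply, Pi.smul_apply, smul_eq_mul]
      rcases σ.symm j with d | d | d <;> simp [crossingMat]
    · intro j
      simp only [gluingMat, eu, fu, Pi.sub_apply, Pi.smul_apply, smul_eq_mul]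
      rcases σ.symm j with d | d | d <;> simp [crossingMat]
  have hneg : permDet ((crossingMat (Function.update τ c t⁻¹)).submatrix
        (swap (Label.over c) (Label.under c)) (swap (Label.over c) (Label.under c))) σ s =
      detRows B hou (eo - t⁻¹ • fo) (eu - fu - (1 - t⁻¹) • fo) := by
    apply hrow
    · intro i hio hiu j
      rw [hsymm, Matrix.submatrix_apply, swap_apply_of_ne_of_ne hio hiu, hagree t⁻¹ i hio hiu,
        swap_apply_self]
      have := hagree 1 i hio hiu
      rw [this]
    · intro j
      simp only [gluingMat, eo, fo, Pi.sub_apply, Pi.smul_apply, smul_eq_mul,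
        Matrix.submatrix_apply, swap_apply_left, swap_apply_def]
      rcases σ.symm j with d | d | d <;> rcases eq_or_ne d c with rfl | hd <;>
        first
        | simp [crossingMat, hd, hd.symm]
        | simp [crossingMat]
    · intro j
      simp only [gluingMat, eu, fu, fo, Pi.sub_apply, Pi.smul_apply, smul_eq_mul,
        Matrix.submatrix_apply, swap_apply_right, swap_apply_def]
      rcases σ.symm j with d | d | d <;> rcases eq_or_ne d c with rfl | hd <;>
        first
        | simp [crossingMat, hd, hd.symm]
        | simp [crossingMat]
  have hzero : permDet (crossingMat (Function.update τ c 1))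
        (σ * swap (Label.over c) (Label.under c)) s = detRows B hou (eo - fu) (eu - fo) := by
    apply hrow
    · intros
      rfl
    · intro j
      simp only [gluingMat, eo, fu, Pi.sub_apply, hsymm, swap_apply_def]
      rcases σ.symm j with d | d | d <;> rcases eq_or_ne d c with rfl | hd <;>
        first
        | simp [crossingMat, hd, hd.symm]
        | simp [crossingMat]
    · intro j
      simp only [gluingMat, eu, fo, Pi.sub_apply, hsymm, swap_apply_def]
      rcases σ.symm j with d | d | d <;> rcases eq_or_ne d c with rfl | hd <;>
        first
        | simp [crossingMat, hd, hd.symm]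
        | simp [crossingMat]
  rw [hpos, hneg, hzero]
  simp only [map_sub, map_smul, LinearMap.sub_apply, LinearMap.smul_apply, smul_eq_mul,
    detRows_self, detRows_swap B hou fu fo]
  rw [detRows_swap B hou fu eu, detRows_swap B hou fo eu]
  field_simp
  ring

end Skein

/-! ### Changing the words without changing the determinant -/

section WordEq

variable {α : Type*} [DecidableEq α] {K : Type*} [Field K] {M : Matrix α α K}

/-- The words `cs'` have no repeated letters and the same determinant as `cs`, provided that `cs`
has no repeated letters. -/
def WordEq (M : Matrix α α K) (cs cs' : List (List α)) : Prop :=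
  cs.flatten.Nodup → cs'.flatten.Nodup ∧ wordDet M cs = wordDet M cs'

theorem WordEq.trans {cs₁ cs₂ cs₃ : List (List α)} (h : WordEq M cs₁ cs₂)
    (h' : WordEq M cs₂ cs₃) : WordEq M cs₁ cs₃ :=
  fun hn => ⟨(h' (h hn).1).1, (h hn).2.trans (h' (h hn).1).2⟩

theorem WordEq.of_perm {cs cs' : List (List α)} (h : cs.Perm cs') : WordEq M cs cs' :=
  fun hn => ⟨h.flatten.nodup_iff.1 hn, wordDet_eq_of_perm hn h⟩

theorem WordEq.of_isRotated {w w' : List α} (h : w ~r w') (cs : List (List α)) :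
    WordEq M (w :: cs) (w' :: cs) := by
  intro hn
  refine ⟨?_, wordDet_eq_of_isRotated (List.nodup_append'.1 hn).1 h⟩
  have : (w ++ cs.flatten).Perm (w' ++ cs.flatten) := h.perm.append_right _
  exact this.nodup_iff.1 hn

theorem eraseLetter_head {x : α} {u v : List α} {cs : List (List α)}
    (hn : ((u ++ x :: v) :: cs).flatten.Nodup) :
    eraseLetter x ((u ++ x :: v) :: cs) = (u ++ v) :: cs := by
  have hx : x ∉ u ∧ x ∉ v ∧ x ∉ cs.flatten := by
    have : ((u ++ x :: v) ++ cs.flatten).Perm (x :: (u ++ v ++ cs.flatten)) := by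
      simp
    have := (List.nodup_cons.1 (this.nodup_iff.1 hn)).1
    simpa only [List.mem_append, not_or, and_assoc] using this
  have hf : ∀ w : List α, x ∉ w → w.filter (fun y => y ≠ x) = w := by
    intro w hw
    refine List.filter_eq_self.2 fun y hy => ?_
    simpa using fun h : y = x => hw (h ▸ hy)
  rw [eraseLetter, List.map_cons, List.filter_append, List.filter_cons_of_neg (by simp), hf u hx.1,
    hf v hx.2.1, List.map_congr_left (g := id), List.map_id]
  intro w hw
  exact hf w fun h => hx.2.2 (List.mem_flatten.2 ⟨w, hw, h⟩)

/-- The condition that `u ++ v` is nonempty says that `x` is not alone in its word, as required by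
`wordDet_eraseLetter`. -/
theorem WordEq.erase {x : α} (hx : IsTrivialAt M x) {u v : List α} (huv : u ++ v ≠ [])
    (cs : List (List α)) : WordEq M ((u ++ x :: v) :: cs) ((u ++ v) :: cs) := by
  intro hn
  rw [← eraseLetter_head hn]
  refine ⟨nodup_eraseLetter hn, wordDet_eraseLetter hn hx ?_⟩
  rw [List.mem_cons, not_or]
  constructor
  · intro h
    have := congrArg List.length h
    simp only [List.length_append, List.length_cons, List.length_nil, zero_add] at this
    apply huv
    rw [← List.length_eq_zero_iff, List.length_append]
    omega
  · intro h
    have hd : (u ++ x :: v).Disjoint cs.flatten := (List.nodup_append'.1 hn).2.2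
    exact hd (a := x) (by simp) (List.mem_flatten.2 ⟨[x], h, by simp⟩)

/-- A trivial base point may be replaced by another one. -/
theorem WordEq.replace {x y : α} (hx : IsTrivialAt M x) (hy : IsTrivialAt M y) {w : List α}
    {cs : List (List α)} (h : y ∉ ((x :: w) :: cs).flatten) :
    WordEq M ((x :: w) :: cs) ((y :: w) :: cs) := by
  intro hn
  -- Both words arise from the word starting with `y`, `x` by erasing one of these two letters.
  have hn' : (([] ++ y :: x :: w) :: cs).flatten.Nodup := List.nodup_cons.2 ⟨h, hn⟩
  have h1 := WordEq.erase hy (u := []) (v := x :: w) (by simp) cs hn'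
  have h2 := WordEq.erase hx (u := [y]) (v := w) (by simp) cs hn'
  exact ⟨h2.1, h1.2.symm.trans h2.2⟩

/-- Two trivial base points may be exchanged. -/
theorem WordEq.exchange {x y : α} (hx : IsTrivialAt M x) (hy : IsTrivialAt M y) (u v : List α)
    (cs : List (List α)) :
    WordEq M ((x :: u) :: (y :: v) :: cs) ((y :: u) :: (x :: v) :: cs) := by
  intro hn
  have hp : ((x :: u) ++ ((y :: v) ++ cs.flatten)).Perm
      ((y :: u) ++ ((x :: v) ++ cs.flatten)) := by
    simp only [List.cons_append]
    exact ((List.perm_middle).cons x).trans ((List.Perm.swap y x _).trans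
      (List.perm_middle.symm.cons y))
  refine ⟨hp.nodup_iff.1 hn, ?_⟩
  -- Two trivial strands are indistinguishable in the matrix, so exchanging their names in the words
  -- costs nothing.
  have hM : M.submatrix (swap x y) (swap x y) = M := by
    ext i j
    rw [Matrix.submatrix_apply]
    by_cases hix : i = x
    · subst hix
      rw [swap_apply_left, (hy _).1, (hx _).1]
      refine if_congr ?_ rfl rfl
      rw [@eq_comm _ y, Equiv.swap_apply_eq_iff, swap_apply_right, eq_comm]
    by_cases hiy : i = y
    · subst hiy
      rw [swap_apply_right, (hy _).1, (hx _).1]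
      refine if_congr ?_ rfl rfl
      rw [@eq_comm _ x, Equiv.swap_apply_eq_iff, swap_apply_left, eq_comm]
    rw [swap_apply_of_ne_of_ne hix hiy]
    by_cases hjx : j = x
    · subst hjx
      rw [swap_apply_left, (hy _).2, (hx _).2, if_neg (Ne.symm hix), if_neg (Ne.symm hiy)]
    by_cases hjy : j = y
    · subst hjy
      rw [swap_apply_right, (hy _).2, (hx _).2, if_neg (Ne.symm hix), if_neg (Ne.symm hiy)]
    rw [swap_apply_of_ne_of_ne hjx hjy]
  have hx' : x ∉ u ++ ((y :: v) ++ cs.flatten) := (List.nodup_cons.1 hn).1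
  have hy' : y ∉ u ++ (v ++ cs.flatten) := by
    have h : (u ++ (y :: (v ++ cs.flatten))).Nodup := (List.nodup_cons.1 hn).2
    exact (List.nodup_cons.1 (List.perm_middle.nodup_iff.1 h)).1
  simp only [List.mem_append, List.mem_cons, not_or] at hx' hy'
  have hf : ∀ w : List α, x ∉ w → y ∉ w → w.map (swap x y) = w := by
    intro w h1 h2
    rw [List.map_congr_left (g := id), List.map_id]
    intro z hz
    apply swap_apply_of_ne_of_ne
    · rintro rfl
      exact h1 hz
    · rintro rfl
      exact h2 hz
  have hmap : ((x :: u) :: (y :: v) :: cs).map (List.map (swap x y)) =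
      (y :: u) :: (x :: v) :: cs := by
    simp only [List.map_cons, swap_apply_left, swap_apply_right]
    rw [hf u hx'.1 hy'.1, hf v hx'.2.1.2 hy'.2.1, List.map_congr_left (g := id), List.map_id]
    intro w hw
    exact hf w (fun h => hx'.2.2 (List.mem_flatten.2 ⟨w, hw, h⟩))
      fun h => hy'.2.2 (List.mem_flatten.2 ⟨w, hw, h⟩)
  rw [← hmap, wordDet_map, hM]

theorem commute_wordPerm_swap {p q : α} {cs : List (List α)} (hp : p ∉ cs.flatten)
    (hq : q ∉ cs.flatten) : wordPerm cs * swap p q = swap p q * wordPerm cs := by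
  rw [Equiv.mul_swap_eq_swap_mul, wordPerm_apply_of_notMem hp, wordPerm_apply_of_notMem hq]

/-- Smoothing a crossing of a component with itself: with successors exchanged, the passage `p`
continues where `q` did and conversely. -/
theorem permDet_split {p q : α} {w v x : List α} {cs : List (List α)}
    (hw : w ~r (p :: v ++ q :: x)) (hn : (w :: cs).flatten.Nodup) :
    ((q :: v) :: (p :: x) :: cs).flatten.Nodup ∧
    permDet M (wordPerm (w :: cs) * swap p q) (w :: cs).flatten.toFinset =
      wordDet M ((q :: v) :: (p :: x) :: cs) := by
  have hp1 : (p :: v ++ q :: x).Perm ((q :: v) ++ (p :: x)) := by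
    simp only [List.cons_append]
    exact ((List.perm_middle).cons p).trans ((List.Perm.swap q p _).trans
      (List.perm_middle.symm.cons q))
  have hp2 : (w :: cs).flatten.Perm ((q :: v) :: (p :: x) :: cs).flatten := by
    simp only [List.flatten_cons]
    rw [← List.append_assoc]
    exact (hw.perm.trans hp1).append_right _
  have hnw := (List.nodup_append'.1 hn).1
  have hd := (List.nodup_append'.1 hn).2.2
  refine ⟨hp2.nodup_iff.1 hn, ?_⟩
  rw [wordDet, List.toFinset_eq_of_perm _ _ hp2, wordPerm_cons, mul_assoc, commute_wordPerm_swap,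
    ← mul_assoc, List.formPerm_eq_of_isRotated hnw hw, formPerm_split (hw.perm.nodup_iff.1 hnw),
    mul_assoc]
  · rfl
  · exact hd (hw.perm.mem_iff.2 (by simp))
  · exact hd (hw.perm.mem_iff.2 (by simp))

/-- Smoothing a crossing of two components: since a transposition is its own inverse, this is
`formPerm_split` read backwards. -/
theorem permDet_merge {p q : α} {w w' v x : List α} {cs cs' : List (List α)}
    (hcs : cs'.Perm (w :: w' :: cs))
    (hw : w ~r (p :: x)) (hw' : w' ~r (q :: v)) (hn : cs'.flatten.Nodup) :
    ((p :: v ++ q :: x) :: cs).flatten.Nodup ∧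
    permDet M (wordPerm cs' * swap p q) cs'.flatten.toFinset =
      wordDet M ((p :: v ++ q :: x) :: cs) := by
  have hn0 : (w :: w' :: cs).flatten.Nodup := hcs.flatten.nodup_iff.1 hn
  have hp2 : (w :: w' :: cs).flatten.Perm ((p :: v ++ q :: x) :: cs).flatten := by
    simp only [List.flatten_cons]
    rw [← List.append_assoc]
    refine List.Perm.append_right _ ((hw.perm.append hw'.perm).trans ?_)
    refine List.perm_append_comm.trans ?_
    simp only [List.cons_append]
    exact ((List.perm_middle).cons q).trans ((List.Perm.swap p q _).trans
      (List.perm_middle.symm.cons p))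
  have hn1 := hp2.nodup_iff.1 hn0
  have hnw := (List.nodup_append'.1 hn1).1
  have hd := (List.nodup_append'.1 hn1).2.2
  have h1 := (List.nodup_append'.1 hn0).1
  have h2 := (List.nodup_append'.1 (List.nodup_append'.1 hn0).2.1).1
  have h3 : w'.Disjoint w := by
    intro z hz hz'
    exact (List.nodup_append'.1 hn0).2.2 hz' (List.mem_append.2 (Or.inl hz))
  have hc : w.formPerm * w'.formPerm = w'.formPerm * w.formPerm := (commute_formPerm h3).eq.symm
  refine ⟨hn1, ?_⟩
  have hfl : cs'.flatten.Perm ((p :: v ++ q :: x) :: cs).flatten := hcs.flatten.trans hp2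
  rw [wordDet, List.toFinset_eq_of_perm _ _ hfl, wordPerm_eq_of_perm hn hcs]
  simp only [wordPerm_cons]
  rw [← mul_assoc, hc, mul_assoc, commute_wordPerm_swap, ← mul_assoc,
    List.formPerm_eq_of_isRotated h1 hw, List.formPerm_eq_of_isRotated h2 hw', ← formPerm_split hnw,
    mul_assoc _ (swap p q) (swap p q), Equiv.swap_mul_self, mul_one]
  · exact hd (by simp)
  · exact hd (by simp)

end WordEq

/-! ### Moving, renaming and reordering base points -/

section BaseWords

variable {K : Type*} [Field K] {τ : ℕ → K}

theorem isTrivialAt_comp {m : ℕ} (hm : m ≠ 0) : IsTrivialAt (crossingMat τ) (Label.comp m) := by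
  intro j
  cases j with
  | comp n =>
    simp only [crossingMat, Label.comp.injEq, hm, ne_eq, not_false_eq_true, and_true, true_and]
    by_cases h : m = n
    · simp [h.symm, hm]
    · simp [h, Ne.symm h]
  | _ => simp [crossingMat]

/-- With `τ c = 1` a crossing decouples into two trivial strands; this makes it possible to erase
the passages of the smoothed crossing. -/
theorem isTrivialAt_over {c : ℕ} : τ c = 1 → IsTrivialAt (crossingMat τ) (Label.over c) := by
  intro hc j
  rcases j with d | d | d
  · simp [crossingMat, eq_comm]
  · rcases eq_or_ne c d with rfl | h <;> simp_all [crossingMat]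
  · simp [crossingMat]

theorem isTrivialAt_under {c : ℕ} : τ c = 1 → IsTrivialAt (crossingMat τ) (Label.under c) := by
  intro hc j
  rcases j with d | d | d
  · rcases eq_or_ne c d with rfl | h
    · simp [crossingMat, hc]
    · simp [crossingMat, h.symm]
  · rcases eq_or_ne c d with rfl | h
    · simp [crossingMat, hc]
    · simp [crossingMat, h, h.symm]
  · simp [crossingMat]

theorem isTrivialAt_label {p : Letter} (hp : τ p.crossing = 1) :
    IsTrivialAt (crossingMat τ) p.label := by
  unfold Letter.label
  by_cases h : p.isOver
  · rw [if_pos h]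
    exact isTrivialAt_over hp
  · rw [if_neg h]
    exact isTrivialAt_under hp

theorem comp_mem_flatten_baseWords {n m : ℕ} {ws : List (List Letter)} :
    Label.comp m ∈ (baseWords n ws).flatten ↔ n ≤ m ∧ m < n + ws.length := by
  rw [(flatten_baseWords_perm n ws).mem_iff, List.mem_append]
  constructor
  · rintro (h | h)
    · simpa using h
    · obtain ⟨p, _, hp⟩ := List.mem_map.1 h
      exact absurd hp (p.label_ne_comp m)
  · intro h
    exact Or.inl (by simpa using h)

theorem comp_notMem_map_label (m : ℕ) (w : List Letter) :
    Label.comp m ∉ w.map Letter.label := by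
  intro h
  obtain ⟨p, _, hp⟩ := List.mem_map.1 h
  exact p.label_ne_comp m hp

/-- Base points are numbered in order, so adding a component changes all later numbers. The later
words are renumbered before the first one, so that the new name is always free. The number `0` is
excluded because `comp 0` is not a trivial strand. -/
theorem WordEq.shift_up {n : ℕ} (hn : n ≠ 0) (ws : List (List Letter)) {cs : List (List Label)}
    (h : ∀ m, n ≤ m → Label.comp m ∉ cs.flatten) :
    WordEq (crossingMat τ) (baseWords n ws ++ cs) (baseWords (n + 1) ws ++ cs) := by
  induction ws generalizing n cs with
  | nil => exact WordEq.of_perm (List.Perm.refl _)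
  | cons w ws ih =>
    simp only [baseWords, List.cons_append]
    refine (WordEq.of_perm List.perm_middle.symm).trans ?_
    refine (ih n.succ_ne_zero ?_).trans ?_
    · intro m hm
      simp only [List.flatten_cons, List.cons_append, List.mem_cons, List.mem_append, not_or,
        Label.comp.injEq]
      exact ⟨by omega, comp_notMem_map_label m w, h m (by omega)⟩
    · refine (WordEq.of_perm List.perm_middle).trans ?_
      apply WordEq.replace (isTrivialAt_comp hn) (isTrivialAt_comp n.succ_ne_zero)
      simp only [List.flatten_cons, List.flatten_append, List.cons_append, List.mem_cons,
        List.mem_append, not_or, Label.comp.injEq, comp_mem_flatten_baseWords]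
      exact ⟨by omega, comp_notMem_map_label _ w, by omega, h _ (by omega)⟩

/-- Here the first word is renamed before the later ones, since the lower number is the free one. -/
theorem WordEq.shift_down {n : ℕ} (hn : n ≠ 0) (ws : List (List Letter)) {cs : List (List Label)}
    (h : ∀ m, n ≤ m → Label.comp m ∉ cs.flatten) :
    WordEq (crossingMat τ) (baseWords (n + 1) ws ++ cs) (baseWords n ws ++ cs) := by
  induction ws generalizing n cs with
  | nil => exact WordEq.of_perm (List.Perm.refl _)
  | cons w ws ih =>
    simp only [baseWords, List.cons_append]
    refine (WordEq.replace (isTrivialAt_comp n.succ_ne_zero) (isTrivialAt_comp hn) ?_).trans ?_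
    · simp only [List.flatten_cons, List.flatten_append, List.cons_append, List.mem_cons,
        List.mem_append, not_or, Label.comp.injEq, comp_mem_flatten_baseWords]
      exact ⟨by omega, comp_notMem_map_label _ w, by omega, h _ le_rfl⟩
    · refine (WordEq.of_perm List.perm_middle.symm).trans ?_
      refine (ih n.succ_ne_zero ?_).trans (WordEq.of_perm List.perm_middle)
      intro m hm
      simp only [List.flatten_cons, List.cons_append, List.mem_cons, List.mem_append, not_or,
        Label.comp.injEq]
      exact ⟨by omega, comp_notMem_map_label m w, h m (by omega)⟩

theorem WordEq.reorder {n : ℕ} (hn : n ≠ 0) {ws ws' : List (List Letter)} (h : ws.Perm ws')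
    (cs : List (List Label)) :
    WordEq (crossingMat τ) (baseWords n ws ++ cs) (baseWords n ws' ++ cs) := by
  induction h generalizing n cs with
  | nil => exact WordEq.of_perm (List.Perm.refl _)
  | cons w _ ih =>
    simp only [baseWords, List.cons_append]
    refine (WordEq.of_perm List.perm_middle.symm).trans ?_
    exact (ih n.succ_ne_zero _).trans (WordEq.of_perm List.perm_middle)
  | swap v w ws =>
    simp only [baseWords, List.cons_append]
    refine (WordEq.exchange (isTrivialAt_comp hn) (isTrivialAt_comp n.succ_ne_zero) _ _ _).trans ?_
    exact WordEq.of_perm (List.Perm.swap _ _ _)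
  | trans _ _ ih₁ ih₂ => exact (ih₁ hn cs).trans (ih₂ hn cs)

/-- A second base point is inserted between `u` and `v`, the cyclic word is rotated to start there,
the old base point is erased, and the new one takes its name. -/
theorem WordEq.rotate {n : ℕ} (hn : n ≠ 0) (u v : List Letter) (ws : List (List Letter))
    {cs : List (List Label)} (h : ∀ m, n ≤ m → Label.comp m ∉ cs.flatten) :
    WordEq (crossingMat τ) (baseWords n ((u ++ v) :: ws) ++ cs)
      (baseWords n ((v ++ u) :: ws) ++ cs) := by
  intro hnd
  -- The base points of these words use the numbers `n, …, n + ws.length`, so `N` is the first one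
  -- above them.
  set N := n + 1 + ws.length with hN
  simp only [baseWords, List.cons_append, List.map_append] at hnd ⊢
  have hfresh : Label.comp N ∉ ((Label.comp n :: (u.map Letter.label ++ v.map Letter.label)) ::
      (baseWords (n + 1) ws ++ cs)).flatten := by
    simp only [List.flatten_cons, List.flatten_append, List.cons_append, List.mem_cons,
      List.mem_append, not_or, Label.comp.injEq, comp_mem_flatten_baseWords]
    exact ⟨by omega, ⟨comp_notMem_map_label _ u, comp_notMem_map_label _ v⟩, by omega,
      h _ (by omega)⟩
  have hnd' : ((Label.comp n :: u.map Letter.label ++ Label.comp N :: v.map Letter.label) ::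
      (baseWords (n + 1) ws ++ cs)).flatten.Nodup := by
    have hp : ((Label.comp n :: u.map Letter.label ++ Label.comp N :: v.map Letter.label) ++
        (baseWords (n + 1) ws ++ cs).flatten).Perm
        (Label.comp N :: ((Label.comp n :: (u.map Letter.label ++ v.map Letter.label)) ++
          (baseWords (n + 1) ws ++ cs).flatten)) := by
      rw [← List.cons_append]
      refine List.Perm.append_right _ ?_
      simpa using List.perm_middle (a := Label.comp N)
        (l₁ := Label.comp n :: u.map Letter.label) (l₂ := v.map Letter.label)
    exact hp.nodup_iff.2 (List.nodup_cons.2 ⟨hfresh, hnd⟩)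
  have hN0 : N ≠ 0 := by omega
  have h1 := WordEq.erase (isTrivialAt_comp (τ := τ) hN0)
    (u := Label.comp n :: u.map Letter.label) (v := v.map Letter.label) (by simp) _ hnd'
  have h2 : WordEq (crossingMat τ)
      ((Label.comp n :: u.map Letter.label ++ Label.comp N :: v.map Letter.label) ::
        (baseWords (n + 1) ws ++ cs))
      ((Label.comp n :: (v.map Letter.label ++ u.map Letter.label)) ::
        (baseWords (n + 1) ws ++ cs)) := by
    refine (WordEq.of_isRotated (w' := (Label.comp N :: v.map Letter.label) ++ Label.comp n ::
      u.map Letter.label) List.isRotated_append _).trans ?_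
    refine (WordEq.erase (isTrivialAt_comp hn) (by simp) _).trans ?_
    refine WordEq.replace (isTrivialAt_comp hN0) (isTrivialAt_comp hn) ?_
    simp only [List.flatten_cons, List.flatten_append, List.cons_append, List.mem_cons,
      List.mem_append, not_or, Label.comp.injEq, comp_mem_flatten_baseWords]
    exact ⟨by omega, fun h' => (List.mem_append.1 h').elim (comp_notMem_map_label _ v)
      (comp_notMem_map_label _ u), by omega, h _ le_rfl⟩
  have h3 := h2 hnd'
  exact ⟨h3.1, h1.2.symm.trans h3.2⟩

/-- A closed component through a trivial passage. -/
theorem WordEq.add_circle {q : Letter} (hq : τ q.crossing = 1) (v : List Letter)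
    (ws : List (List Letter)) {w : List Label} (hw : ∀ m ≠ 0, Label.comp m ∉ w) :
    WordEq (crossingMat τ) ((q.label :: v.map Letter.label) :: w :: baseWords 1 ws)
      (w :: baseWords 1 (v :: ws)) := by
  -- Renumbering the existing circles frees `comp 1`, which then replaces the trivial letter `q` as
  -- base point of the new circle.
  refine (WordEq.of_perm (cs' := baseWords 1 ws ++ [q.label :: v.map Letter.label, w])
    List.perm_append_comm).trans ?_
  refine (WordEq.shift_up one_ne_zero ws ?_).trans ?_
  · intro m hm
    simp only [List.flatten_cons, List.flatten_nil, List.append_nil, List.cons_append,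
      List.mem_cons, List.mem_append, not_or]
    exact ⟨(q.label_ne_comp m).symm, comp_notMem_map_label m v, hw m (by omega)⟩
  refine (WordEq.of_perm (cs' := (q.label :: v.map Letter.label) :: w :: baseWords 2 ws)
    List.perm_append_comm).trans ?_
  refine (WordEq.replace (y := Label.comp 1) (isTrivialAt_label hq)
    (isTrivialAt_comp one_ne_zero) ?_).trans (WordEq.of_perm (List.Perm.swap _ _ _))
  simp only [List.flatten_cons, List.cons_append, List.mem_cons, List.mem_append, not_or,
    comp_mem_flatten_baseWords]
  exact ⟨(q.label_ne_comp 1).symm, comp_notMem_map_label 1 v, hw 1 one_ne_zero, by omega⟩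

end BaseWords

/-! ### From words of passages to words of labels -/

theorem mem_baseWords {n : ℕ} {ws : List (List Letter)} {w : List Letter} (hw : w ∈ ws) :
    ∃ m, (Label.comp m :: w.map Letter.label) ∈ baseWords n ws := by
  induction ws generalizing n with
  | nil => simp at hw
  | cons v ws ih =>
    rcases List.mem_cons.1 hw with rfl | hw
    · exact ⟨n, by simp [baseWords]⟩
    · obtain ⟨m, hm⟩ := ih (n := n + 1) hw
      exact ⟨m, List.mem_cons_of_mem _ hm⟩

theorem hasBase_baseWords (n : ℕ) (ws : List (List Letter)) : HasBase (baseWords n ws) := by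
  induction ws generalizing n with
  | nil => simp [HasBase, baseWords]
  | cons v ws ih =>
    intro w hw
    rcases List.mem_cons.1 hw with rfl | hw
    · exact ⟨n, by simp⟩
    · exact ih _ w hw

theorem baseWords_map {f : Letter → Letter} {e : Label → Label} (n : ℕ) (ws : List (List Letter))
    (he : ∀ m, e (Label.comp m) = Label.comp m)
    (h : ∀ p ∈ ws.flatten, (f p).label = e p.label) :
    baseWords n (ws.map (List.map f)) = (baseWords n ws).map (List.map e) := by
  induction ws generalizing n with
  | nil => rfl
  | cons w ws ih =>
    simp only [List.map_cons, baseWords, he, List.map_map, List.flatten_cons,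
      List.mem_append] at h ⊢
    rw [ih _ fun p hp => h p (Or.inr hp)]
    congr 2
    exact List.map_congr_left fun p hp => h p (Or.inl hp)

theorem baseWords_filter {f : Letter → Bool} {e : Label → Bool} (n : ℕ) (ws : List (List Letter))
    (he : ∀ m, e (Label.comp m) = true) (h : ∀ p, f p = e p.label) :
    baseWords n (ws.map (List.filter f)) = (baseWords n ws).map (List.filter e) := by
  induction ws generalizing n with
  | nil => rfl
  | cons w ws ih =>
    simp only [List.map_cons, baseWords]
    rw [ih, List.filter_cons_of_pos (he n), List.filter_map]
    congr 4
    funext p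
    exact h p

/-! ### Invariance of writhe and trace invariant under the moves -/

namespace Diagram

variable {D D' : Diagram}

/-- The contribution of a passage to the writhe. -/
def weight (p : Letter) : ℤ := if p.isOver then p.sign else 0

theorem writhe_eq_sum (D : Diagram) : D.writhe = (D.letters.map weight).sum := by
  rw [writhe, overLetters]
  induction D.letters with
  | nil => rfl
  | cons p w ih =>
    by_cases hp : p.isOver
    · rw [List.filter_cons_of_pos (by simpa using hp)]
      simp [weight, hp, ih]
    · rw [List.filter_cons_of_neg (by simpa using hp)]
      simp [weight, hp, ih]

theorem writhe_eq_of_perm (h : D.letters.Perm D'.letters) : D.writhe = D'.writhe := by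
  rw [writhe_eq_sum, writhe_eq_sum]
  exact (h.map _).sum_eq

theorem HasPowers.of_subset {τ : ℕ → RatFunc ℚ} (hτ : D.HasPowers τ)
    (h : D'.letters ⊆ D.letters) : D'.HasPowers τ :=
  fun p hp => hτ p (h hp)

theorem nodup_letters (D : Diagram) : D.letters.Nodup := List.Nodup.of_map _ D.nodup

theorem Adj.exists_word {p q : Letter} (h : D.Adj p q) :
    ∃ w ∈ D.strand :: D.circles, [p, q] <:+: w := by
  rcases h with h | ⟨w, hw, h⟩
  · exact ⟨_, List.mem_cons_self, h⟩
  · exact ⟨w, List.mem_cons_of_mem _ hw, h⟩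

theorem Adj.mem {p q : Letter} (h : D.Adj p q) : p ∈ D.letters ∧ q ∈ D.letters := by
  obtain ⟨w, hw, h⟩ := h.exists_word
  have hs : ∀ x ∈ w, x ∈ D.letters := fun x hx => List.mem_flatten.2 ⟨w, hw, hx⟩
  exact ⟨hs _ (h.subset (by simp)), hs _ (h.subset (by simp))⟩

theorem Adj.ne {p q : Letter} (h : D.Adj p q) : p ≠ q := by
  obtain ⟨w, hw, h⟩ := h.exists_word
  have hn : w.Nodup :=
    (List.nodup_flatten (L := D.strand :: D.circles).1 D.nodup_letters).1 w hw
  simpa using hn.sublist h.sublist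

theorem Adj.wordPerm {p q : Letter} (h : D.Adj p q) :
    wordPerm D.words p.label = q.label := by
  obtain ⟨w, hw, u, v, rfl⟩ := h.exists_word
  obtain ⟨m, hm⟩ := mem_baseWords (n := 0) hw
  refine wordPerm_apply_of_infix D.nodup_words hm ?_
  exact ⟨Label.comp m :: u.map Letter.label, v.map Letter.label, by simp⟩

theorem IsImage.eq_map {f : List Letter → List Letter} (h : IsImage f D D') :
    D'.strand :: D'.circles = (D.strand :: D.circles).map f := by
  rw [h.1, h.2, List.map_cons]

theorem IsImage.letters_map {f : Letter → Letter} (h : IsImage (List.map f) D D') :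
    D'.letters = D.letters.map f := by
  have : D'.letters = (D'.strand :: D'.circles).flatten := rfl
  rw [this, h.eq_map, ← List.map_flatten]
  rfl

theorem IsImage.words_map {f : Letter → Letter} (h : IsImage (List.map f) D D')
    {e : Label → Label} (he : ∀ m, e (Label.comp m) = Label.comp m)
    (hf : ∀ p ∈ D.letters, (f p).label = e p.label) : D'.words = D.words.map (List.map e) := by
  rw [words, h.eq_map]
  exact baseWords_map 0 _ he hf

/-- The writhe and the trace invariant of two diagrams agree. -/
def SameInvariants (D D' : Diagram) : Prop := D.writhe = D'.writhe ∧ D.omega = D'.omega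

theorem sameInvariants_of_perm (hl : D.letters.Perm D'.letters)
    (h : ∀ τ : ℕ → RatFunc ℚ, WordEq (crossingMat τ) D.words D'.words) : D.SameInvariants D' := by
  refine ⟨writhe_eq_of_perm hl, ?_⟩
  obtain ⟨τ, hτ⟩ := D.exists_hasPowers
  rw [omega_eq_wordDet hτ, omega_eq_wordDet (hτ.of_subset hl.symm.subset)]
  exact (h τ D.nodup_words).2

/-! ### Change of names, base points and order -/

/-- Renaming of the crossings, on labels. -/
def _root_.WLink.Label.rename (f : Perm ℕ) : Perm Label where
  toFun
    | Label.over c => Label.over (f c)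
    | Label.under c => Label.under (f c)
    | Label.comp m => Label.comp m
  invFun
    | Label.over c => Label.over (f.symm c)
    | Label.under c => Label.under (f.symm c)
    | Label.comp m => Label.comp m
  left_inv := by rintro (c | c | c) <;> simp
  right_inv := by rintro (c | c | c) <;> simp

theorem sameInvariants_rename (f : Perm ℕ) (h : IsImage (List.map (Letter.rename f)) D D') :
    D.SameInvariants D' := by
  constructor
  · rw [writhe_eq_sum, writhe_eq_sum, h.letters_map, List.map_map]
    rfl
  · obtain ⟨τ, hτ⟩ := D.exists_hasPowers
    -- The crossing called `f c` in `D'` has the sign of `c` in `D`.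
    have hτ' : D'.HasPowers (τ ∘ f.symm) := by
      intro p hp
      rw [h.letters_map] at hp
      obtain ⟨q, hq, rfl⟩ := List.mem_map.1 hp
      simpa [Letter.rename] using hτ q hq
    rw [omega_eq_wordDet hτ, omega_eq_wordDet hτ',
      h.words_map (e := Label.rename f) (fun _ => rfl), wordDet_map]
    · congr 1
      ext i j : 2
      rcases i with c | c | c <;> rcases j with d | d | d <;>
        simp [Label.rename, crossingMat]
    · rintro ⟨c, ε, _ | _⟩ _ <;> rfl

theorem sameInvariants_rotate {u v : List Letter} {rest : List (List Letter)}
    (hs : D'.strand = D.strand) (h : D.circles = (u ++ v) :: rest)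
    (h' : D'.circles = (v ++ u) :: rest) : D.SameInvariants D' := by
  apply sameInvariants_of_perm
  · rw [letters, letters, hs, h, h']
    refine List.Perm.append_left _ ?_
    exact List.Perm.append_right _ List.perm_append_comm
  · intro τ
    rw [words, words, hs, h, h']
    refine (WordEq.of_perm (cs' := baseWords 1 ((u ++ v) :: rest) ++
      [Label.comp 0 :: D.strand.map Letter.label]) (List.perm_append_comm (l₁ := [_]))).trans ?_
    refine (WordEq.rotate one_ne_zero u v rest ?_).trans
      (WordEq.of_perm (List.perm_append_comm (l₂ := [_])))
    intro m hm
    simp only [List.flatten_cons, List.flatten_nil, List.append_nil, List.mem_cons, not_or,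
      Label.comp.injEq]
    exact ⟨by omega, comp_notMem_map_label m _⟩

theorem sameInvariants_reorder (hs : D'.strand = D.strand) (h : D.circles.Perm D'.circles) :
    D.SameInvariants D' := by
  apply sameInvariants_of_perm
  · rw [letters, letters, hs]
    exact List.Perm.append_left _ h.flatten
  · intro τ
    rw [words, words, hs]
    refine (WordEq.of_perm (cs' := baseWords 1 D.circles ++
      [Label.comp 0 :: D.strand.map Letter.label]) (List.perm_append_comm (l₁ := [_]))).trans ?_
    exact (WordEq.reorder one_ne_zero h _).trans
      (WordEq.of_perm (List.perm_append_comm (l₂ := [_])))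

/-! ### Exchange of letters -/

theorem swap_mem {a b p : Letter} (ha : a ∈ D.letters) (hb : b ∈ D.letters)
    (hp : p ∈ D.letters) : swap a b p ∈ D.letters := by
  rw [swap_apply_def]
  split_ifs <;> assumption

theorem label_injOn {p q : Letter} (hp : p ∈ D.letters) (hq : q ∈ D.letters)
    (h : p.label = q.label) : p = q :=
  eq_of_crossing_eq hp hq (Letter.label_eq_label_iff.1 h).1 (Letter.label_eq_label_iff.1 h).2

theorem label_swap {a b p : Letter} (ha : a ∈ D.letters) (hb : b ∈ D.letters)
    (hp : p ∈ D.letters) : (swap a b p).label = swap a.label b.label p.label := by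
  by_cases h1 : p = a
  · rw [h1, swap_apply_left, swap_apply_left]
  by_cases h2 : p = b
  · rw [h2, swap_apply_right, swap_apply_right]
  rw [swap_apply_of_ne_of_ne h1 h2, swap_apply_of_ne_of_ne]
  · exact fun h => h1 (label_injOn hp ha h)
  · exact fun h => h2 (label_injOn hp hb h)

/-- Exchanging passages of the diagram keeps the set of passages, hence the writhe and the signs;
only the words change. By `wordDet_map` this change of words can be transferred to the matrix. -/
theorem sameInvariants_of_exchange {f : Perm Letter} {e : Perm Label}
    (h : IsImage (List.map f) D D') (he : ∀ m, e (Label.comp m) = Label.comp m)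
    (hf : ∀ p ∈ D.letters, f p ∈ D.letters) (hfe : ∀ p ∈ D.letters, (f p).label = e p.label)
    (hdet : ∀ τ, D.HasPowers τ → wordDet (crossingMat τ) D.words =
      wordDet ((crossingMat τ).submatrix e e) D.words) : D.SameInvariants D' := by
  have hl : D'.letters.Perm D.letters := by
    rw [h.letters_map]
    refine (List.Nodup.subperm (D.nodup_letters.map f.injective) ?_).perm_of_length_le (by simp)
    intro p hp
    obtain ⟨q, hq, rfl⟩ := List.mem_map.1 hp
    exact hf q hq
  refine ⟨(writhe_eq_of_perm hl).symm, ?_⟩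
  obtain ⟨τ, hτ⟩ := D.exists_hasPowers
  rw [omega_eq_wordDet hτ, omega_eq_wordDet (hτ.of_subset hl.subset), h.words_map he hfe,
    wordDet_map, hdet τ hτ]

theorem _root_.WLink.Letter.label_of_isOver {p : Letter} (hp : p.isOver = true) :
    p.label = Label.over p.crossing := if_pos hp

theorem _root_.WLink.Letter.label_flip_of_isOver {p : Letter} (hp : p.isOver = true) :
    p.flip.label = Label.under p.crossing := by
  simp [Letter.label, Letter.flip, hp]

theorem crossing_ne {a b : Letter} (ha : a ∈ D.letters) (hb : b ∈ D.letters) (hab : a ≠ b)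
    (hao : a.isOver = true) (hbo : b.isOver = true) : a.crossing ≠ b.crossing :=
  fun h => hab (eq_of_crossing_eq ha hb h (hao.trans hbo.symm))

theorem sameInvariants_oc {a b : Letter} (ha : a.isOver = true) (hb : b.isOver = true)
    (hover : D.Adj a b) (h : IsImage (List.map (swap a b)) D D') : D.SameInvariants D' := by
  have hab := crossing_ne hover.mem.1 hover.mem.2 hover.ne ha hb
  have hp := hover.wordPerm
  rw [Letter.label_of_isOver ha, Letter.label_of_isOver hb] at hp
  refine sameInvariants_of_exchange (e := swap (Label.over a.crossing) (Label.over b.crossing)) h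
    (fun m => swap_apply_of_ne_of_ne (by simp) (by simp))
    (fun p hp => swap_mem hover.mem.1 hover.mem.2 hp) ?_ ?_
  · intro p hp
    rw [label_swap hover.mem.1 hover.mem.2 hp, Letter.label_of_isOver ha,
      Letter.label_of_isOver hb]
  · intro τ _
    exact wordDet_swap D.nodup_words (by simpa using hab) hp
      (fun i => crossingMat_over τ i _) (fun i => crossingMat_over τ i _)

theorem AdjSigned.mem {ε : ℤˣ} {p q : Letter} (h : D.AdjSigned ε p q) :
    p ∈ D.letters ∧ q ∈ D.letters := by
  unfold AdjSigned at h
  split_ifs at h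
  · exact h.mem
  · exact h.mem.symm

theorem AdjSigned.isArc {ε : ℤˣ} {p q : Letter} (h : D.AdjSigned ε p q) :
    IsArc D.words ε p.label q.label := by
  unfold AdjSigned at h
  unfold IsArc
  split_ifs at h ⊢
  · exact h.wordPerm
  · exact h.wordPerm

theorem sqrtT_ne_zero : sqrtT ≠ 0 := RatFunc.X_ne_zero

theorem sameInvariants_r3 {tm tb mb : Letter} {κ : ℤˣ}
    (htm : tm.isOver = true) (htb : tb.isOver = true) (hmb : mb.isOver = true)
    (h₁ : tm.crossing ≠ tb.crossing) (h₂ : tm.crossing ≠ mb.crossing)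
    (h₃ : tb.crossing ≠ mb.crossing)
    (top : D.AdjSigned (κ * tb.sign) tm tb)
    (middle : D.AdjSigned (κ * mb.sign) tm.flip mb)
    (bottom : D.AdjSigned (κ * tm.sign * mb.sign * tb.sign) tb.flip mb.flip)
    (h : IsImage (List.map fun p => swap tm tb (swap tm.flip mb (swap tb.flip mb.flip p))) D D') :
    D.SameInvariants D' := by
  have m1 := top.mem
  have m2 := middle.mem
  have m3 := bottom.mem
  have l1 := Letter.label_of_isOver htm
  have l2 := Letter.label_of_isOver htb
  have l3 := Letter.label_of_isOver hmb
  have l4 := Letter.label_flip_of_isOver htm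
  have l5 := Letter.label_flip_of_isOver htb
  have l6 := Letter.label_flip_of_isOver hmb
  have top' := top.isArc
  have middle' := middle.isArc
  have bottom' := bottom.isArc
  rw [l1, l2] at top'
  rw [l4, l3] at middle'
  rw [l5, l6] at bottom'
  have hmem : ∀ p ∈ D.letters, swap tm.flip mb (swap tb.flip mb.flip p) ∈ D.letters :=
    fun p hp => swap_mem m2.1 m2.2 (swap_mem m3.1 m3.2 hp)
  refine sameInvariants_of_exchange (f := swap tm tb * swap tm.flip mb * swap tb.flip mb.flip)
    (e := swap (Label.over tm.crossing) (Label.over tb.crossing) *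
      swap (Label.under tm.crossing) (Label.over mb.crossing) *
      swap (Label.under tb.crossing) (Label.under mb.crossing)) h ?_ ?_ ?_ ?_
  · intro m
    simp [swap_apply_of_ne_of_ne]
  · intro p hp
    exact swap_mem m1.1 m1.2 (hmem p hp)
  · intro p hp
    rw [Perm.mul_apply, Perm.mul_apply, Perm.mul_apply, Perm.mul_apply,
      label_swap m1.1 m1.2 (hmem p hp), label_swap m2.1 m2.2 (swap_mem m3.1 m3.2 hp),
      label_swap m3.1 m3.2 hp, l1, l2, l3, l4, l5, l6]
  · intro τ hτ
    have hκ : ((κ : ℤˣ) : ℤ) * κ = 1 := by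
      rw [← Units.val_mul, Int.units_mul_self, Units.val_one]
    have ht : ((tb.sign : ℤˣ) : ℤ) * tb.sign = 1 := by
      rw [← Units.val_mul, Int.units_mul_self, Units.val_one]
    have hm : ((mb.sign : ℤˣ) : ℤ) * mb.sign = 1 := by
      rw [← Units.val_mul, Int.units_mul_self, Units.val_one]
    -- The reversal `κ` is absorbed into `u = t ^ κ`; the exponents then match since the square of
    -- every sign is `1`.
    refine wordDet_reidemeister3 D.nodup_words h₁ h₂ h₃ top' middle' bottom'
      (u := (sqrtT ^ 2) ^ (κ : ℤ)) (zpow_ne_zero _ (pow_ne_zero _ sqrtT_ne_zero)) ?_ ?_ ?_ rfl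
    · rw [hτ tm m1.1, ← zpow_mul]
      congr 1
      push_cast
      linear_combination (-(tm.sign : ℤ) * (κ * κ) * (κ * κ) * (mb.sign * mb.sign)) * ht -
        (tm.sign : ℤ) * (κ * κ) * (κ * κ) * hm - (tm.sign : ℤ) * (1 + κ * κ) * hκ
    · rw [hτ tb m1.2, ← zpow_mul]
      congr 1
      push_cast
      linear_combination -(tb.sign : ℤ) * hκ
    · rw [hτ mb m2.2, ← zpow_mul]
      congr 1
      push_cast
      linear_combination -(mb.sign : ℤ) * hκ

/-! ### Reidemeister 2 -/

theorem sameInvariants_r2 {a b : Letter} (ha : a.isOver = true) (hb : b.isOver = true)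
    (hsign : b.sign = -a.sign) (hover : D.Adj a b)
    (hunder : D.Adj a.flip b.flip ∨ D.Adj b.flip a.flip)
    (h : IsImage (List.filter fun p => p.crossing ≠ a.crossing ∧ p.crossing ≠ b.crossing) D D') :
    D.SameInvariants D' := by
  have hab := crossing_ne hover.mem.1 hover.mem.2 hover.ne ha hb
  have hl : D'.letters =
      D.letters.filter fun p => p.crossing ≠ a.crossing ∧ p.crossing ≠ b.crossing := by
    have h1 : D'.letters = (D'.strand :: D'.circles).flatten := rfl
    have h2 : D.letters = (D.strand :: D.circles).flatten := rfl
    rw [h1, h2, h.eq_map, List.filter_flatten]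
  have la := Letter.label_of_isOver ha
  have lb := Letter.label_of_isOver hb
  have la' := Letter.label_flip_of_isOver ha
  have lb' := Letter.label_flip_of_isOver hb
  constructor
  -- Exactly four passages disappear; the two over-passages among them have opposite signs, so the
  -- writhe is unchanged.
  · have hnd : (a :: b :: a.flip :: b.flip :: D'.letters).Nodup := by
      have hfa : a.flip.isOver = false := by simp [Letter.flip, ha]
      have hfb : b.flip.isOver = false := by simp [Letter.flip, hb]
      have n1 : a ≠ b := hover.ne
      have n2 : a ≠ a.flip := fun h => by rw [← h, ha] at hfa; simp at hfa
      have n3 : a ≠ b.flip := fun h => by rw [← h, ha] at hfb; simp at hfb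
      have n4 : b ≠ a.flip := fun h => by rw [← h, hb] at hfa; simp at hfa
      have n5 : b ≠ b.flip := fun h => by rw [← h, hb] at hfb; simp at hfb
      have n6 : a.flip ≠ b.flip := fun h => hab (congrArg Letter.crossing h :)
      rw [hl]
      simp only [List.nodup_cons, List.mem_cons, List.mem_filter, not_or]
      refine ⟨⟨n1, n2, n3, by simp⟩, ⟨n4, n5, by simp⟩, ⟨n6, by simp [Letter.flip]⟩,
        by simp [Letter.flip], D.nodup_letters.filter _⟩
    have hp : D.letters.Perm (a :: b :: a.flip :: b.flip :: D'.letters) := by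
      refine (List.perm_ext_iff_of_nodup D.nodup_letters hnd).2 fun p => ?_
      simp only [hl, List.mem_cons, List.mem_filter, decide_eq_true_eq]
      constructor
      · intro hp
        have key : ∀ c ∈ D.letters, p.crossing = c.crossing → p = c ∨ p = c.flip := by
          intro c hc hpc
          by_cases ho : p.isOver = c.isOver
          · exact Or.inl (eq_of_crossing_eq hp hc hpc ho)
          · refine Or.inr (eq_of_crossing_eq hp (D.flip_mem c hc) hpc ?_)
            simpa [Letter.flip, Bool.eq_not] using ho
        by_cases h1 : p.crossing = a.crossing
        · rcases key a hover.mem.1 h1 with h | h <;> simp [h]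
        by_cases h2 : p.crossing = b.crossing
        · rcases key b hover.mem.2 h2 with h | h <;> simp [h]
        exact Or.inr (Or.inr (Or.inr (Or.inr ⟨hp, h1, h2⟩)))
      · rintro (rfl | rfl | rfl | rfl | h)
        · exact hover.mem.1
        · exact hover.mem.2
        · exact D.flip_mem _ hover.mem.1
        · exact D.flip_mem _ hover.mem.2
        · exact h.1
    rw [writhe_eq_sum, writhe_eq_sum, (hp.map weight).sum_eq]
    simp [weight, Letter.flip, ha, hb, hsign]
  · obtain ⟨τ, hτ⟩ := D.exists_hasPowers
    have hτ' : D'.HasPowers τ := hτ.of_subset (by rw [hl]; exact List.filter_subset_self _)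
    have hinv : τ a.crossing * τ b.crossing = 1 := by
      rw [hτ a hover.mem.1, hτ b hover.mem.2, hsign, ← zpow_add₀ (pow_ne_zero _ sqrtT_ne_zero)]
      simp
    have hp := hover.wordPerm
    rw [la, lb] at hp
    have hQ : ∀ x y : Label, (x = Label.under a.crossing ∧ y = Label.under b.crossing) ∨
        (x = Label.under b.crossing ∧ y = Label.under a.crossing) →
        eraseLetter x (eraseLetter (Label.over a.crossing)
          (eraseLetter y (eraseLetter (Label.over b.crossing) D.words))) = D'.words := by
      intro x y hxy
      rw [words, words, h.eq_map]
      rw [baseWords_filter (e := fun l => l ≠ Label.over a.crossing ∧ l ≠ Label.over b.crossing ∧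
        l ≠ Label.under a.crossing ∧ l ≠ Label.under b.crossing) 0 _ (by simp)]
      · simp only [eraseLetter, List.map_map]
        apply List.map_congr_left
        intro w _
        simp only [Function.comp_apply, List.filter_filter]
        congr 1
        funext l
        rcases hxy with ⟨rfl, rfl⟩ | ⟨rfl, rfl⟩ <;> simp only [← Bool.decide_and] <;> congr 1 <;>
          simp only [eq_iff_iff] <;> tauto
      · rintro ⟨c, ε, _ | _⟩ <;> simp [Letter.label]
    rw [omega_eq_wordDet hτ, omega_eq_wordDet hτ']
    rcases hunder with hu | hu
    · have hu := hu.wordPerm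
      rw [la', lb'] at hu
      rw [wordDet_reidemeister2 D.nodup_words (hasBase_baseWords _ _) hab (Or.inl ⟨rfl, rfl⟩) hp hu
        hinv, hQ _ _ (Or.inl ⟨rfl, rfl⟩)]
    · have hu := hu.wordPerm
      rw [la', lb'] at hu
      rw [wordDet_reidemeister2 D.nodup_words (hasBase_baseWords _ _) hab (Or.inr ⟨rfl, rfl⟩) hp hu
        hinv, hQ _ _ (Or.inr ⟨rfl, rfl⟩)]

theorem sameInvariants_of_move (h : Move D D') : D.SameInvariants D' := by
  cases h with
  | rename f h => exact sameInvariants_rename f h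
  | rotate u v rest hs h h' => exact sameInvariants_rotate hs h h'
  | reorder hs h => exact sameInvariants_reorder hs h
  | r2 a b ha hb hsign hover hunder h => exact sameInvariants_r2 ha hb hsign hover hunder h
  | r3 tm tb mb κ htm htb hmb h₁ h₂ h₃ top middle bottom h =>
    exact sameInvariants_r3 htm htb hmb h₁ h₂ h₃ top middle bottom h
  | oc a b ha hb hover h => exact sameInvariants_oc ha hb hover h

end Diagram

/-! ### Smoothings and the unnormalized skein relation -/

namespace Diagram

variable {D D₀ D' : Diagram} {c : ℕ}

theorem IsSmoothing.exists_perm (h : IsSmoothing c D D₀) :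
    ∃ p q : Letter, p.crossing = c ∧ q.crossing = c ∧ D.letters.Perm (p :: q :: D₀.letters) := by
  have key : ∀ (p q : Letter) (l₁ l₂ l₃ : List Letter),
      (l₁ ++ p :: (l₂ ++ q :: l₃)).Perm (p :: q :: (l₁ ++ (l₂ ++ l₃))) := by
    intro p q l₁ l₂ l₃
    refine List.perm_middle.trans (List.Perm.cons _ ?_)
    rw [← List.append_assoc, ← List.append_assoc]
    exact List.perm_middle
  have comm : ∀ u v w : List Letter, (u ++ (v ++ w)).Perm (v ++ (u ++ w)) := by
    intro u v w
    rw [← List.append_assoc, ← List.append_assoc]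
    exact List.perm_append_comm.append_right _
  cases h with
  | open_open p q hp hq u v w hs hs₀ h₀ =>
    refine ⟨p, q, hp, hq, ?_⟩
    rw [letters, letters, hs, hs₀, h₀]
    have := key p q u v (w ++ D.circles.flatten)
    simp only [List.append_assoc, List.cons_append, List.flatten_cons] at this ⊢
    exact this.trans (((comm v w _).append_left u).cons _ |>.cons _)
  | open_closed p q hp hq u v w hs h hs₀ =>
    refine ⟨p, q, hp, hq, ?_⟩
    rw [letters, letters, hs, h, hs₀]
    have := key p q u w (v ++ D₀.circles.flatten)
    simp only [List.append_assoc, List.cons_append, List.flatten_cons] at this ⊢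
    exact this.trans (((comm w v _).append_left u).cons _ |>.cons _)
  | closed_self p q hp hq u v rest h hs₀ h₀ =>
    refine ⟨p, q, hp, hq, ?_⟩
    rw [letters, letters, h, hs₀, h₀]
    have := key p q D.strand u (v ++ rest.flatten)
    simpa only [List.append_assoc, List.cons_append, List.flatten_cons] using this
  | closed_closed p q hp hq u v rest h hs₀ h₀ =>
    refine ⟨p, q, hp, hq, ?_⟩
    rw [letters, letters, h, hs₀, h₀]
    have := key p q D.strand u (v ++ rest.flatten)
    simpa only [List.append_assoc, List.cons_append, List.flatten_cons] using this

section TwoPassages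

variable {p q : Letter} {l : List Letter}

theorem isOver_ne (hp : p.crossing = c) (hq : q.crossing = c)
    (h : D.letters.Perm (p :: q :: l)) : q.isOver = !p.isOver := by
  have hn := h.nodup_iff.1 D.nodup_letters
  have hpq : p ≠ q := by
    rintro rfl
    simp at hn
  by_contra ho
  apply hpq
  refine eq_of_crossing_eq (h.mem_iff.2 (by simp)) (h.mem_iff.2 (by simp)) (hp.trans hq.symm) ?_
  revert ho
  cases p.isOver <;> cases q.isOver <;> simp

theorem swap_label_eq (hp : p.crossing = c) (hq : q.crossing = c)
    (h : D.letters.Perm (p :: q :: l)) :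
    swap p.label q.label = swap (Label.over c) (Label.under c) := by
  have ho := isOver_ne hp hq h
  unfold Letter.label
  rw [hp, hq, ho]
  cases p.isOver
  · simp [swap_comm]
  · simp

theorem crossing_ne_of_mem (hp : p.crossing = c) (hq : q.crossing = c)
    (h : D.letters.Perm (p :: q :: l)) {r : Letter} (hr : r ∈ l) : r.crossing ≠ c := by
  intro hrc
  have hn := h.nodup_iff.1 D.nodup_letters
  have ho := isOver_ne hp hq h
  have hrD : r ∈ D.letters := h.mem_iff.2 (by simp [hr])
  simp only [List.nodup_cons, List.mem_cons, not_or] at hn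
  by_cases h1 : r.isOver = p.isOver
  · have := eq_of_crossing_eq hrD (h.mem_iff.2 (by simp)) (hrc.trans hp.symm) h1
    exact hn.1.2 (this ▸ hr)
  · have := eq_of_crossing_eq (q := q) hrD (h.mem_iff.2 (by simp)) (hrc.trans hq.symm)
      (by rw [ho]; simpa [Bool.eq_not] using h1)
    exact hn.2.1 (this ▸ hr)

end TwoPassages

/-- The determinant of the smoothed diagram. -/
theorem IsSmoothing.permDet_eq (h : IsSmoothing c D D₀) {τ : ℕ → RatFunc ℚ} (hτ : τ c = 1) :
    permDet (crossingMat τ) (wordPerm D.words * swap (Label.over c) (Label.under c))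
      D.words.flatten.toFinset = wordDet (crossingMat τ) D₀.words := by
  obtain ⟨p', q', hp', hq', hperm⟩ := h.exists_perm
  -- The transposition does not depend on which of the two passages is the over-passage, so all four
  -- smoothings can ignore this.
  have hswap : ∀ p q : Letter, p ∈ D.letters → q ∈ D.letters → p ≠ q → p.crossing = c →
      q.crossing = c → swap p.label q.label = swap (Label.over c) (Label.under c) := by
    intro p q hp hq hpq hpc hqc
    have hq' : q ∈ D.letters.erase p := (List.mem_erase_of_ne hpq.symm).2 hq
    exact swap_label_eq hpc hqc ((List.perm_cons_erase hp).trans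
      ((List.perm_cons_erase hq').cons p))
  have hnd := D.nodup_letters
  have hnw := D.nodup_words
  have triv : ∀ {r : Letter}, r.crossing = c → IsTrivialAt (crossingMat τ) r.label :=
    fun hr => isTrivialAt_label (by rw [hr, hτ])
  cases h with
  | open_open p q hp hq u v w hs hs₀ h₀ =>
    rw [← hswap p q (by simp [letters, hs]) (by simp [letters, hs])
      (by rintro rfl; simp [letters, hs, List.nodup_append] at hnd) hp hq]
    rw [words, hs] at hnw ⊢
    rw [words, hs₀, h₀]
    simp only [baseWords, List.map_append, List.map_cons] at hnw ⊢
    set U := u.map Letter.label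
    set V := v.map Letter.label with hV
    set W := w.map Letter.label
    have hr : (Label.comp 0 :: (U ++ p.label :: (V ++ q.label :: W))) ~r
        (p.label :: V ++ q.label :: (W ++ Label.comp 0 :: U)) := by
      simpa using List.isRotated_append (l := Label.comp 0 :: U)
        (l' := p.label :: (V ++ q.label :: W))
    obtain ⟨h1, h2⟩ := permDet_split (M := crossingMat τ) hr hnw
    rw [h2]
    refine (WordEq.trans (WordEq.of_perm (List.Perm.swap _ _ _)) ?_ h1).2
    -- The passage `p` is erased from the part that stays open, while `q` is kept to serve as base
    -- point of the part split off as a circle.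
    refine (WordEq.erase (u := []) (triv hp) (by simp) _).trans ?_
    refine (WordEq.of_isRotated (w' := Label.comp 0 :: U ++ W) List.isRotated_append _).trans ?_
    refine (WordEq.of_perm (List.Perm.swap _ _ _)).trans ?_
    refine WordEq.add_circle (by rw [hq, hτ]) v D.circles ?_
    intro m hm hmem
    rcases List.mem_append.1 hmem with hmem | hmem
    · rcases List.mem_cons.1 hmem with hmem | hmem
      · exact hm (Label.comp.inj hmem)
      · exact comp_notMem_map_label m u hmem
    · exact comp_notMem_map_label m w hmem
  | open_closed p q hp hq u v w hs h hs₀ =>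
    rw [← hswap p q (by simp [letters, hs]) (by simp [letters, h])
      (by rintro rfl; simp [letters, hs, h, List.nodup_append] at hnd) hp hq]
    rw [words, hs, h] at hnw ⊢
    rw [words, hs₀]
    simp only [baseWords, List.map_append, List.map_cons] at hnw ⊢
    set U := u.map Letter.label
    set V := v.map Letter.label
    set W := w.map Letter.label
    obtain ⟨h1, h2⟩ := permDet_merge (M := crossingMat τ) (p := p.label) (q := q.label)
      (x := W ++ Label.comp 0 :: U) (v := V ++ [Label.comp 1]) (List.Perm.refl _)
      (by simpa using List.isRotated_append (l := Label.comp 0 :: U) (l' := p.label :: W))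
      (by simpa using List.isRotated_append (l := [Label.comp 1]) (l' := q.label :: V)) hnw
    rw [h2]
    refine (WordEq.trans (cs₂ := (V ++ Label.comp 1 :: (W ++ Label.comp 0 :: U)) ::
      baseWords 2 D₀.circles) ?_ ?_ h1).2
    · refine (WordEq.erase (u := []) (triv hp) (by simp) _).trans ?_
      refine (WordEq.erase (triv hq) (by simp) _).trans ?_
      simpa using WordEq.of_perm (List.Perm.refl _)
    -- The absorbed circle no longer needs a base point, and the remaining circles move down by one.
    refine (WordEq.erase (isTrivialAt_comp one_ne_zero) (by simp) _).trans ?_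
    refine (WordEq.of_isRotated (w' := Label.comp 0 :: (U ++ (V ++ W))) ?_ _).trans ?_
    · simpa using List.isRotated_append (l := V ++ W) (l' := Label.comp 0 :: U)
    refine (WordEq.of_perm (List.perm_append_comm (l₁ := [_]))).trans ?_
    refine (WordEq.shift_down one_ne_zero D₀.circles ?_).trans
      (WordEq.of_perm (List.perm_append_comm (l₂ := [_])))
    intro m hm
    simp only [List.flatten_cons, List.flatten_nil, List.append_nil, List.mem_cons,
      List.mem_append, not_or, Label.comp.injEq]
    exact ⟨by omega, comp_notMem_map_label m u, comp_notMem_map_label m v,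
      comp_notMem_map_label m w⟩
  | closed_self p q hp hq u v rest h hs₀ h₀ =>
    rw [← hswap p q (by simp [letters, h]) (by simp [letters, h])
      (by rintro rfl; simp [letters, h, List.nodup_append] at hnd) hp hq]
    rw [words, h] at hnw ⊢
    rw [words, hs₀, h₀]
    simp only [baseWords, List.map_append, List.map_cons] at hnw ⊢
    set S := D.strand.map Letter.label with hS
    set U := u.map Letter.label
    set V := v.map Letter.label
    have hr : (Label.comp 1 :: p.label :: (U ++ q.label :: V)) ~r
        (p.label :: U ++ q.label :: (V ++ [Label.comp 1])) := by
      simpa using List.isRotated_append (l := [Label.comp 1])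
        (l' := p.label :: (U ++ q.label :: V))
    have hsw := List.Perm.swap (Label.comp 1 :: p.label :: (U ++ q.label :: V))
      (Label.comp 0 :: S) (baseWords 2 rest)
    have hnw' := hsw.flatten.nodup_iff.1 hnw
    rw [wordPerm_eq_of_perm hnw hsw, List.toFinset_eq_of_perm _ _ hsw.flatten]
    obtain ⟨h1, h2⟩ := permDet_split (M := crossingMat τ) hr hnw'
    rw [h2]
    refine (WordEq.trans (WordEq.of_perm (List.Perm.swap _ _ _)) ?_ h1).2
    refine (WordEq.erase (u := []) (triv hp) (by simp) _).trans ?_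
    refine (WordEq.of_isRotated (w' := Label.comp 1 :: V) ?_ _).trans ?_
    · simpa using List.isRotated_append (l := V) (l' := [Label.comp 1])
    -- The part `v` has kept the base point `comp 1`, so it counts as an existing circle, and `u` is
    -- the new one.
    refine (WordEq.of_perm ?_).trans
      (WordEq.add_circle (q := q) (by rw [hq, hτ]) u (v :: rest) (w := Label.comp 0 :: S) ?_)
    · exact (List.Perm.swap _ _ _).trans ((List.Perm.swap _ _ _).cons _)
    · intro m hm hmem
      rcases List.mem_cons.1 hmem with hmem | hmem
      · exact hm (Label.comp.inj hmem)
      · exact comp_notMem_map_label m _ hmem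
  | closed_closed p q hp hq u v rest h hs₀ h₀ =>
    rw [← hswap p q (by simp [letters, h]) (by simp [letters, h])
      (by rintro rfl; simp [letters, h, List.nodup_append] at hnd) hp hq]
    rw [words, h] at hnw ⊢
    rw [words, hs₀, h₀]
    simp only [baseWords, List.map_append, List.map_cons] at hnw ⊢
    set S := D.strand.map Letter.label with hS
    set U := u.map Letter.label
    set V := v.map Letter.label
    obtain ⟨h1, h2⟩ := permDet_merge (M := crossingMat τ) (p := p.label) (q := q.label)
      (w := Label.comp 1 :: p.label :: U) (w' := Label.comp 2 :: q.label :: V)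
      (x := U ++ [Label.comp 1]) (v := V ++ [Label.comp 2])
      (cs := (Label.comp 0 :: S) :: baseWords 3 rest)
      ((List.Perm.swap _ _ _).trans ((List.Perm.swap _ _ _).cons _))
      (by simpa using List.isRotated_append (l := [Label.comp 1]) (l' := p.label :: U))
      (by simpa using List.isRotated_append (l := [Label.comp 2]) (l' := q.label :: V)) hnw
    rw [h2]
    refine (WordEq.trans (cs₂ := ((V ++ Label.comp 2 :: U) ++ Label.comp 1 :: []) ::
      (Label.comp 0 :: S) :: baseWords 3 rest) ?_ ?_ h1).2
    · refine (WordEq.erase (u := []) (triv hp) (by simp) _).trans ?_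
      refine (WordEq.erase (triv hq) (by simp) _).trans ?_
      simpa using WordEq.of_perm (List.Perm.refl _)
    refine (WordEq.erase (isTrivialAt_comp one_ne_zero) (by simp) _).trans ?_
    refine (WordEq.of_isRotated (w' := Label.comp 2 :: (U ++ V)) ?_ _).trans ?_
    · simpa using List.isRotated_append (l := V) (l' := Label.comp 2 :: U)
    -- One of the two base points on the merged circle has been erased; the survivor is renamed from
    -- `comp 2` to `comp 1`.
    refine (WordEq.replace (y := Label.comp 1) (isTrivialAt_comp two_ne_zero)
      (isTrivialAt_comp one_ne_zero) ?_).trans ?_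
    · simp only [List.flatten_cons, List.cons_append, List.mem_cons, List.mem_append, not_or,
        Label.comp.injEq, comp_mem_flatten_baseWords]
      exact ⟨by omega, ⟨comp_notMem_map_label 1 u, comp_notMem_map_label 1 v⟩, by omega,
        comp_notMem_map_label 1 _, by omega⟩
    refine (WordEq.of_perm (cs' := baseWords 3 rest ++
      [Label.comp 0 :: S, Label.comp 1 :: (U ++ V)]) ?_).trans ?_
    · exact (List.Perm.swap _ _ _).trans (List.perm_append_comm (l₁ := [_, _]))
    refine (WordEq.shift_down two_ne_zero rest ?_).trans
      (WordEq.of_perm (List.perm_append_comm (l₂ := [_, _])))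
    intro m hm
    simp only [List.flatten_cons, List.flatten_nil, List.append_nil, List.cons_append,
      List.mem_cons, List.mem_append, not_or, Label.comp.injEq]
    exact ⟨by omega, comp_notMem_map_label m _, by omega, comp_notMem_map_label m u,
      comp_notMem_map_label m v⟩

theorem label_switch (c : ℕ) (p : Letter) :
    (p.switch c).label = swap (Label.over c) (Label.under c) p.label := by
  rcases p with ⟨d, ε, o⟩
  by_cases h : d = c
  · subst h
    cases o <;> simp [Letter.switch, Letter.label]
  · cases o <;> simp [Letter.switch, Letter.label, h, swap_apply_of_ne_of_ne]

/-- The skein relation for the unnormalized invariant. -/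
theorem IsSmoothing.omega_skein (h : IsSmoothing c D D₀)
    (hpos : ∃ p ∈ D.letters, p.crossing = c ∧ p.sign = 1)
    (hsw : IsImage (List.map (Letter.switch c)) D D') :
    D.omega - sqrtT ^ 2 * D'.omega = (1 - sqrtT ^ 2) * D₀.omega := by
  obtain ⟨p, hp, hpc, hps⟩ := hpos
  obtain ⟨p', q', hp', hq', hperm⟩ := h.exists_perm
  obtain ⟨τ, hτ⟩ := D.exists_hasPowers
  have hτc : τ c = sqrtT ^ 2 := by
    have := hτ p hp
    rwa [hpc, hps, Units.val_one, zpow_one] at this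
  have hsign : ∀ r ∈ D.letters, r.crossing = c → r.sign = 1 := fun r hr hrc => by
    rw [sign_eq_of_crossing_eq hr hp (hrc.trans hpc.symm), hps]
  have h1 : D.HasPowers (Function.update τ c (sqrtT ^ 2)) := by
    rwa [← hτc, Function.update_eq_self]
  have h2 : D'.HasPowers (Function.update τ c (sqrtT ^ 2)⁻¹) := by
    intro r hr
    rw [hsw.letters_map] at hr
    obtain ⟨s, hs, rfl⟩ := List.mem_map.1 hr
    by_cases hsc : s.crossing = c
    · simp [Letter.switch, hsc, hsign s hs hsc]
    · simpa [Letter.switch, hsc] using hτ s hs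
  -- The crossing `c` does not occur in `D₀`, so its value there is free; with the value `1` its two
  -- strands become trivial.
  have h3 : D₀.HasPowers (Function.update τ c 1) := by
    intro r hr
    rw [Function.update_of_ne (crossing_ne_of_mem hp' hq' hperm hr)]
    exact hτ r (hperm.mem_iff.2 (by simp [hr]))
  have hmem : ∀ r ∈ D.letters, r.label ∈ D.words.flatten.toFinset := fun r hr =>
    List.mem_toFinset.2 (mem_flatten_words.2 (Or.inr ⟨r, hr, rfl⟩))
  have ho := isOver_ne hp' hq' hperm
  have h4 := hmem p' (hperm.mem_iff.2 (by simp))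
  have h5 := hmem q' (hperm.mem_iff.2 (by simp))
  have h6 : Label.over c ∈ D.words.flatten.toFinset ∧
      Label.under c ∈ D.words.flatten.toFinset := by
    unfold Letter.label at h4 h5
    rw [hp'] at h4
    rw [hq', ho] at h5
    cases hb : p'.isOver
    · rw [hb] at h4 h5
      exact ⟨h5, h4⟩
    · rw [hb] at h4 h5
      exact ⟨h4, h5⟩
  rw [omega_eq_wordDet h1, omega_eq_wordDet h2, omega_eq_wordDet h3,
    hsw.words_map (fun m => swap_apply_of_ne_of_ne (by simp) (by simp))
      (fun r _ => label_switch c r), wordDet_map, ← h.permDet_eq (Function.update_self ..)]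
  exact permDet_skein h6.1 h6.2 (pow_ne_zero _ sqrtT_ne_zero)

theorem IsSmoothing.writhe_eq (h : IsSmoothing c D D₀)
    (hpos : ∃ p ∈ D.letters, p.crossing = c ∧ p.sign = 1)
    (hsw : IsImage (List.map (Letter.switch c)) D D') :
    D.writhe = D₀.writhe + 1 ∧ D'.writhe = D₀.writhe - 1 := by
  obtain ⟨r, hr, hrc, hrs⟩ := hpos
  obtain ⟨p, q, hp, hq, hperm⟩ := h.exists_perm
  have hps : p.sign = 1 := by
    rw [sign_eq_of_crossing_eq (hperm.mem_iff.2 (by simp)) hr (hp.trans hrc.symm), hrs]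
  have hqs : q.sign = 1 := by
    rw [sign_eq_of_crossing_eq (hperm.mem_iff.2 (by simp)) hr (hq.trans hrc.symm), hrs]
  have ho := isOver_ne hp hq hperm
  have hmap : D₀.letters.map (Letter.switch c) = D₀.letters := by
    rw [List.map_congr_left (g := id), List.map_id]
    intro s hs
    simp [Letter.switch, crossing_ne_of_mem hp hq hperm hs]
  rw [writhe_eq_sum, writhe_eq_sum, writhe_eq_sum, hsw.letters_map, (hperm.map weight).sum_eq,
    ((hperm.map (Letter.switch c)).map weight).sum_eq]
  simp only [List.map_cons, hmap, List.sum_cons, weight, Letter.switch, hp, hq, if_true, hps, hqs,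
    ho]
  cases p.isOver
  · simp
    omega
  · simp
    omega

/-! ### Normalization by the writhe -/

/-- The normalized trace invariant `t^{-w/2} ω`. -/
def alexander (D : Diagram) : RatFunc ℚ := sqrtT ^ (-D.writhe) * D.omega

theorem alexander_eq_of_move {D D' : Diagram} (h : Move D D') : D.alexander = D'.alexander := by
  obtain ⟨hw, ho⟩ := sameInvariants_of_move h
  rw [alexander, alexander, hw, ho]

end Diagram

/-- The invariant `Δ` of long w-links. -/
def LongWLink.alexander : LongWLink → RatFunc ℚ :=
  Quot.lift Diagram.alexander fun _ _ h => Diagram.alexander_eq_of_move h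

theorem LongWLink.alexander_skein {Lp Lm L₀ : LongWLink} (h : IsSkeinTriple Lp Lm L₀) :
    Lp.alexander - Lm.alexander = (sqrtT⁻¹ - sqrtT) * L₀.alexander := by
  obtain ⟨Dp, Dm, D₀, c, rfl, rfl, rfl, hpos, hsw, hsm⟩ := h
  change Dp.alexander - Dm.alexander = (sqrtT⁻¹ - sqrtT) * D₀.alexander
  obtain ⟨h1, h2⟩ := hsm.writhe_eq hpos hsw
  have h3 := hsm.omega_skein hpos hsw
  have h0 := Diagram.sqrtT_ne_zero
  have e1 : sqrtT ^ (-(D₀.writhe + 1)) = sqrtT ^ (-D₀.writhe) * sqrtT⁻¹ := by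
    rw [neg_add, zpow_add₀ h0, zpow_neg_one]
  have e2 : sqrtT ^ (-(D₀.writhe - 1)) = sqrtT ^ (-D₀.writhe) * sqrtT := by
    rw [neg_sub, sub_eq_neg_add, zpow_add₀ h0, zpow_one]
  have e3 : sqrtT⁻¹ * sqrtT = 1 := inv_mul_cancel₀ h0
  rw [Diagram.alexander, Diagram.alexander, Diagram.alexander, h1, h2, e1, e2]
  -- The unnormalized relation is multiplied by `t^{-(w₀+1)/2}`, where `w₀` is the writhe of the
  -- smoothing; the second term replaces `sqrtT⁻¹ * sqrtT ^ 2` by `sqrtT`.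
  linear_combination sqrtT ^ (-D₀.writhe) * sqrtT⁻¹ * h3 +
    sqrtT ^ (-D₀.writhe) * sqrtT * (Dm.omega - D₀.omega) * e3

end WLink

end

theorem mainTheorem5 :
    ∃ Δ : WLink.LongWLink → RatFunc ℚ,
      (∀ D : WLink.Diagram,
        Δ (WLink.LongWLink.mk D) = WLink.sqrtT ^ (-D.writhe) * D.omega) ∧
      ∀ Lp Lm L₀ : WLink.LongWLink, WLink.IsSkeinTriple Lp Lm L₀ →
        Δ Lp - Δ Lm = (WLink.sqrtT⁻¹ - WLink.sqrtT) * Δ L₀ :=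
  ⟨WLink.LongWLink.alexander, fun _ => rfl, fun _ _ _ h => WLink.LongWLink.alexander_skein h⟩
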